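/- Let $N\ge 0$ be an integer, let $\mathbb T^N=\mathbb R^N/\mathbb Z^N$ (total measure $1$), let $b_l,b_r:\mathbb T^N\to\mathbb R$ be continuous, let $f_l<f_r$ be real numbers, and put $$D=\{(x,y)\in\mathbb T^N\times\mathbb R : b_l(x)<y<b_r(x)\},\qquad \Omega=\mathbb T^N\times(f_l,f_r),\qquad T=f_r-f_l .$$ Define $$R=\min\{\max b_r-f_r,\ f_l-\min b_l\}-\max\{\max b_r-\min b_r,\ \max b_l-\min b_l\},$$ $$\bar m=\min\{\max b_r-f_r,\ f_l-\min b_l\},\qquad m=\min\{\min b_r-f_r,\ f_l-\max b_l\},$$ where the maxima and minima of $b_l,b_r$ are taken over $\mathbb T^N$, and assume $R>0$. Let $H^1_0(D)$ denote the closure of $C_c^\infty(D)$ in $H^1(D)$. For $a>0$, call $\boldsymbol s=\boldsymbol s_a\in H^1_0(D)^{N+1}$ a weak solution of $-a\Delta\boldsymbol s+(1-\chi_\Omega)\boldsymbol s=-\nabla\chi_\Omega$ in $D$, $\boldsymbol s=\boldsymbol 0$ on $\partial D$, if $$a\int_D\nabla\boldsymbol s:\nabla\boldsymbol u+\int_{D\setminus\Omega}\boldsymbol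 s\cdot\boldsymbol u=\int_\Omega\operatorname{div}\boldsymbol u\qquad\text{for all }\boldsymbol u\in H^1_0(D)^{N+1},$$ and define its thickness function by $h^a_{\boldsymbol s}=\dfrac{2}{\sqrt a\,\operatorname{div}\boldsymbol s}$ (so $1/h^a_{\boldsymbol s}=\tfrac{\sqrt a}{2}\operatorname{div}\boldsymbol s$). Theorem (straight film shapes). One has $\bar m>0$ and $m>0$, and for every $a>0$ and every weak solution $\boldsymbol s$, $$\left\|\frac1{h^a_{\boldsymbol s}}-\frac1T\right\|_{L^2(\Omega)}\le\frac{2}{T^{3/2}}\sqrt a+\frac{4}{\sqrt T}\,e^{-2\bar m/\sqrt a}+\frac1{\sqrt m}\,e^{-R/\sqrt a}.$$ In particular, if $\boldsymbol s_a$ is a weak solution for each $a>0$, then $\displaystyle\int_\Omega\left|\frac1{h^a_{\boldsymbol s_a}}-\frac1T\right|^2\to0$ as $a\to0^+$. -/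

import Mathlib

open MeasureTheory Filter Topology
open scoped ContDiff

namespace StraightFilm

/-- The space `𝕋^N × ℝ`, where `𝕋^N = ℝ^N / ℤ^N` is the flat torus. Its volume is the product of
the (total mass one) Lebesgue measure of the torus and the Lebesgue measure of `ℝ`. -/
abbrev Space (N : ℕ) : Type := UnitAddTorus (Fin N) × ℝ

/-- Labels of the `N + 1` coordinates of `𝕋^N × ℝ`: `Sum.inl j` is the coordinate `x_j` and
`Sum.inr ()` is the coordinate `y`. -/
abbrev Coord (N : ℕ) : Type := Fin N ⊕ Unit

/-- The quotient map `ℝ^N × ℝ → 𝕋^N × ℝ`. -/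
def proj {N : ℕ} (z : (Fin N → ℝ) × ℝ) : Space N :=
  (fun j => ((z.1 j : ℝ) : UnitAddCircle), z.2)

/-- The displacement by `t` in the direction of the coordinate `i`. -/
def shift {N : ℕ} : Coord N → ℝ → Space N
  | Sum.inl j, t => (Pi.single j (t : UnitAddCircle), 0)
  | Sum.inr _, t => (0, t)

/-- The classical partial derivative of `φ` at `p` in the coordinate `i`. -/
noncomputable def partialDeriv {N : ℕ} (i : Coord N) (φ : Space N → ℝ) (p : Space N) : ℝ :=
  deriv (fun t : ℝ => φ (p + shift i t)) 0

/-- `φ ∈ C_c^∞(D)`: `φ` is smooth on `𝕋^N × ℝ` (its periodic lift to `ℝ^N × ℝ` is smooth) and has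
compact support contained in `D`. -/
structure IsTestFunction {N : ℕ} (D : Set (Space N)) (φ : Space N → ℝ) : Prop where
  smooth : ContDiff ℝ ∞ (fun z : (Fin N → ℝ) × ℝ => φ (proj z))
  compact : HasCompactSupport φ
  support : tsupport φ ⊆ D

/-- `u ∈ H^1(D)` with weak partial derivatives `g i` (`i` a coordinate). -/
structure MemH1 {N : ℕ} (D : Set (Space N)) (u : Space N → ℝ) (g : Coord N → Space N → ℝ) :
    Prop where
  memLp : MemLp u 2 (volume.restrict D)
  grad_memLp : ∀ i, MemLp (g i) 2 (volume.restrict D)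
  weak_deriv : ∀ φ, IsTestFunction D φ → ∀ i,
    ∫ p in D, u p * partialDeriv i φ p = - ∫ p in D, g i p * φ p

/-- `u ∈ H^1_0(D)`, the closure of `C_c^∞(D)` in `H^1(D)`, with weak partial derivatives `g i`. -/
structure MemH10 {N : ℕ} (D : Set (Space N)) (u : Space N → ℝ) (g : Coord N → Space N → ℝ) :
    Prop extends MemH1 D u g where
  approx : ∃ φ : ℕ → Space N → ℝ, (∀ n, IsTestFunction D (φ n)) ∧
    Tendsto (fun n => eLpNorm (fun p => φ n p - u p) 2 (volume.restrict D)) atTop (𝓝 0) ∧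
    ∀ i, Tendsto (fun n => eLpNorm (fun p => partialDeriv i (φ n) p - g i p) 2
      (volume.restrict D)) atTop (𝓝 0)

/-- `s = (s_i)`, with weak Jacobian `Ds i j = ∂_j s_i`, is a weak solution in `H^1_0(D)^{N+1}` of
`-a Δ s + (1 - χ_Ω) s = -∇χ_Ω` in `D`, `s = 0` on `∂D`. -/
structure IsWeakSolution {N : ℕ} (D Ω : Set (Space N)) (a : ℝ)
    (s : Coord N → Space N → ℝ) (Ds : Coord N → Coord N → Space N → ℝ) : Prop where
  memH10 : ∀ i, MemH10 D (s i) (Ds i)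
  weak_form : ∀ (u : Coord N → Space N → ℝ) (Du : Coord N → Coord N → Space N → ℝ),
    (∀ i, MemH10 D (u i) (Du i)) →
    a * (∫ p in D, ∑ i, ∑ j, Ds i j p * Du i j p) + ∫ p in D \ Ω, ∑ i, s i p * u i p
      = ∫ p in Ω, ∑ i, Du i i p

/-- The local thickness `h = 2 / (√a div s)`, in terms of the weak Jacobian `Ds` of `s`. -/
noncomputable def thickness {N : ℕ} (a : ℝ) (Ds : Coord N → Coord N → Space N → ℝ)
    (p : Space N) : ℝ :=
  2 / (√a * ∑ i, Ds i i p)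

/-- The global domain `D = {(x, y) | b_l(x) < y < b_r(x)}`. -/
def globalDomain {N : ℕ} (bl br : UnitAddTorus (Fin N) → ℝ) : Set (Space N) :=
  {p | bl p.1 < p.2 ∧ p.2 < br p.1}

/-- The straight film `Ω = 𝕋^N × (f_l, f_r)`. -/
def film (N : ℕ) (fl fr : ℝ) : Set (Space N) :=
  {p | fl < p.2 ∧ p.2 < fr}

/-- `R = min {max b_r - f_r, f_l - min b_l} - max {max b_r - min b_r, max b_l - min b_l}`. -/
noncomputable def marginR {N : ℕ} (bl br : UnitAddTorus (Fin N) → ℝ) (fl fr : ℝ) : ℝ :=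
  min ((⨆ x, br x) - fr) (fl - ⨅ x, bl x)
    - max ((⨆ x, br x) - ⨅ x, br x) ((⨆ x, bl x) - ⨅ x, bl x)

/-- `m̄ = min {max b_r - f_r, f_l - min b_l}`. -/
noncomputable def outerMargin {N : ℕ} (bl br : UnitAddTorus (Fin N) → ℝ) (fl fr : ℝ) : ℝ :=
  min ((⨆ x, br x) - fr) (fl - ⨅ x, bl x)

/-- `m = min {min b_r - f_r, f_l - max b_l}`. -/
noncomputable def innerMargin {N : ℕ} (bl br : UnitAddTorus (Fin N) → ℝ) (fl fr : ℝ) : ℝ :=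
  min ((⨅ x, br x) - fr) (fl - ⨆ x, bl x)

end StraightFilm

/-! Put k = √a and T = f_r - f_l, let E(u,v) = k²∫_D Du:Dv + ∫_{D∖Ω} u·v be the energy form and L(u)
= ∫_Ω div u. The equation says E(s,u) = L(u) on H¹₀(D). If D were the whole cylinder, the solution
would be an explicit vertical field V: linear in y with slope A on the film and decaying like
e^{-dist/k} outside it, where A(k² + kT/2) = 1. Its thickness is T + 2k, since kA/2 = 1/(T + 2k),
and this accounts for the term of order √a. It remains to show that cutting the cylinder down to D
changes div s on the film only by an exponentially small amount.

V does not vanish on ∂D, but it still satisfies E(V,u) = L(u) for all u in H¹₀(D)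
(`integral_energyDensity_freeProfile`). Let C be a competitor which is V with its tail replaced by
one vanishing at distance μ < m from the film; it lies in H¹₀(D). Expanding E(s-V,s-V) and
E(s-C,s-C) and adding, the unknown L(s) cancels, and the sum of the two energies is bounded by
explicit hyperbolic functions of μ/k.

For μ/k ≤ 7/10 this bound on s - C suffices. For larger μ/k, w = s - V solves the homogeneous
equation; testing with η²w, where η solves k²η'' = η outside the film, gains a further factor
1/sinh²(μ/k) (`IsWeakSolution.integral_film_div_sub_sq_le_of_freeProfile`). In both regimes,
gradients are converted into divergences by ∫_D (div z)² ≤ ∫_D |Dz|² for z in H¹₀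
(`integral_div_sq_le`), without a dimensional constant.

Letting μ → m gives a bound with e^{-m/√a} and without the middle term. Since R ≤ m, this is
stronger than the stated estimate. -/

namespace StraightFilm

/-! ### Test functions on 𝕋^N × ℝ and integration by parts. -/

variable {N : ℕ} {D : Set (Space N)} {φ χ : Space N → ℝ}

instance : IsProbabilityMeasure (volume : Measure UnitAddCircle) := ⟨UnitAddCircle.measure_univ⟩

instance : IsProbabilityMeasure (volume : Measure (UnitAddTorus (Fin N))) :=
  inferInstanceAs (IsProbabilityMeasure (Measure.pi fun _ => volume))

instance : Measure.IsAddLeftInvariant (volume : Measure (Space N)) :=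
  Measure.prod.instIsAddLeftInvariant

/-- The unit vector of `ℝ^N × ℝ` in the direction of the coordinate `i`. -/
def unitVec : Coord N → (Fin N → ℝ) × ℝ
  | Sum.inl j => (Pi.single j 1, 0)
  | Sum.inr _ => (0, 1)

theorem proj_add_smul (i : Coord N) (z : (Fin N → ℝ) × ℝ) (t : ℝ) :
    proj (z + t • unitVec i) = proj z + shift i t := by
  rcases i with j | j
  · ext k
    · by_cases h : k = j
      · subst h; simp [proj, shift, unitVec]
      · simp [proj, shift, unitVec, h]
    · simp [proj, shift, unitVec]
  · ext k <;> simp [proj, shift, unitVec]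

theorem isOpenQuotientMap_proj : IsOpenQuotientMap (proj : (Fin N → ℝ) × ℝ → Space N) :=
  (IsOpenQuotientMap.piMap fun _ => QuotientAddGroup.isOpenQuotientMap_mk).prodMap
    IsOpenQuotientMap.id

theorem shift_zero (i : Coord N) : (shift i 0 : Space N) = 0 := by
  rcases i with j | j <;> simp [shift]

theorem continuous_shift (i : Coord N) : Continuous (shift i : ℝ → Space N) := by
  rcases i with j | j
  · refine Continuous.prodMk ?_ continuous_const
    exact (continuous_single j).comp (AddCircle.continuous_mk' 1)
  · exact Continuous.prodMk continuous_const continuous_id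

theorem partialDeriv_proj_eq_lineDeriv (i : Coord N) (φ : Space N → ℝ) (z : (Fin N → ℝ) × ℝ) :
    partialDeriv i φ (proj z) = lineDeriv ℝ (fun z => φ (proj z)) z (unitVec i) := by
  simp only [partialDeriv, lineDeriv, proj_add_smul]

namespace IsTestFunction

theorem partialDeriv_proj (h : IsTestFunction D φ) (i : Coord N) (z : (Fin N → ℝ) × ℝ) :
    partialDeriv i φ (proj z) = fderiv ℝ (fun z => φ (proj z)) z (unitVec i) := by
  rw [partialDeriv_proj_eq_lineDeriv]
  exact ((h.smooth.differentiable (by simp)) z).lineDeriv_eq_fderiv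

theorem continuous (h : IsTestFunction D φ) : Continuous φ :=
  isOpenQuotientMap_proj.isQuotientMap.continuous_iff.2 h.smooth.continuous

theorem hasDerivAt (h : IsTestFunction D φ) (i : Coord N) (p : Space N) (t : ℝ) :
    HasDerivAt (fun t => φ (p + shift i t)) (partialDeriv i φ (p + shift i t)) t := by
  obtain ⟨z, rfl⟩ := isOpenQuotientMap_proj.surjective p
  rw [← proj_add_smul, h.partialDeriv_proj]
  simp only [← proj_add_smul]
  have h1 : HasFDerivAt (fun z => φ (proj z))
      (fderiv ℝ (fun z => φ (proj z)) (z + t • unitVec i)) (z + t • unitVec i) :=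
    ((h.smooth.differentiable (by simp)) _).hasFDerivAt
  have h2 : HasDerivAt (fun t : ℝ => z + t • unitVec i) (unitVec i) t := by
    simpa using ((hasDerivAt_id t).smul_const (unitVec i)).const_add z
  exact h1.comp_hasDerivAt t h2

theorem partialDeriv_eq_zero_of_notMem (φ : Space N → ℝ) (i : Coord N) {p : Space N}
    (hp : p ∉ tsupport φ) :
    partialDeriv i φ p = 0 := by
  have h1 : ∀ᶠ q in 𝓝 p, φ q = 0 := by
    filter_upwards [(isClosed_tsupport φ).isOpen_compl.mem_nhds hp] with q hq
    exact image_eq_zero_of_notMem_tsupport hq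
  have h2 : Tendsto (fun t : ℝ => p + shift i t) (𝓝 0) (𝓝 p) := by
    have : Continuous fun t : ℝ => p + shift i t := continuous_const.add (continuous_shift i)
    simpa [shift_zero] using this.tendsto 0
  have h3 : (fun t : ℝ => φ (p + shift i t)) =ᶠ[𝓝 0] fun _ => 0 := h2.eventually h1
  rw [partialDeriv, h3.deriv_eq]; simp

theorem tsupport_partialDeriv_subset (φ : Space N → ℝ) (i : Coord N) :
    tsupport (partialDeriv i φ) ⊆ tsupport φ :=
  closure_minimal (fun p hp => by
    by_contra h
    exact hp (partialDeriv_eq_zero_of_notMem φ i h)) (isClosed_tsupport φ)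

theorem partialDeriv (h : IsTestFunction D φ) (i : Coord N) :
    IsTestFunction D (partialDeriv i φ) where
  smooth := by
    simp only [h.partialDeriv_proj]
    exact (h.smooth.fderiv_right (m := ∞) (by simp)).clm_apply contDiff_const
  compact := h.compact.mono' (subset_closure.trans (tsupport_partialDeriv_subset φ i))
  support := (tsupport_partialDeriv_subset φ i).trans h.support

/-- Symmetry of the second derivative of the periodic lift. It is the source of the exchange of
derivatives behind `integral_div_sq_le`. -/
theorem partialDeriv_comm (h : IsTestFunction D φ) (i j : Coord N) (p : Space N) :
    StraightFilm.partialDeriv i (StraightFilm.partialDeriv j φ) p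
      = StraightFilm.partialDeriv j (StraightFilm.partialDeriv i φ) p := by
  obtain ⟨z, rfl⟩ := isOpenQuotientMap_proj.surjective p
  rw [(h.partialDeriv j).partialDeriv_proj, (h.partialDeriv i).partialDeriv_proj]
  simp only [h.partialDeriv_proj]
  have hd : DifferentiableAt ℝ (fderiv ℝ (fun z => φ (proj z))) z :=
    ((h.smooth.fderiv_right (m := ∞) (by simp)).differentiable (by simp)) z
  rw [fderiv_clm_apply hd (differentiableAt_const _),
    fderiv_clm_apply hd (differentiableAt_const _)]
  have hs : IsSymmSndFDerivAt ℝ (fun z => φ (proj z)) z :=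
    (h.smooth.contDiffAt).isSymmSndFDerivAt (by
      rw [minSmoothness_of_isRCLikeNormedField]
      exact ENat.LEInfty.out)
  simpa using hs (unitVec i) (unitVec j)

theorem mul_snd (h : IsTestFunction D φ) {G : ℝ → ℝ} (hG : ContDiff ℝ ∞ G) :
    IsTestFunction D (fun p => G p.2 * φ p) where
  smooth := (hG.comp contDiff_snd).mul h.smooth
  compact := h.compact.mul_left
  support := (tsupport_mul_subset_right).trans h.support

theorem mul (h : IsTestFunction D φ) (h' : IsTestFunction D χ) :
    IsTestFunction D (fun p => φ p * χ p) where
  smooth := h.smooth.mul h'.smooth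
  compact := h'.compact.mul_left
  support := (tsupport_mul_subset_right).trans h'.support

theorem hasDerivAt_zero (h : IsTestFunction D φ) (i : Coord N) (p : Space N) :
    HasDerivAt (fun t => φ (p + shift i t)) (StraightFilm.partialDeriv i φ p) 0 := by
  simpa [shift_zero] using h.hasDerivAt i p 0

theorem partialDeriv_mul (h : IsTestFunction D φ) (h' : IsTestFunction D χ) (i : Coord N)
    (p : Space N) : StraightFilm.partialDeriv i (fun p => φ p * χ p) p
      = StraightFilm.partialDeriv i φ p * χ p + φ p * StraightFilm.partialDeriv i χ p := by
  have h1 := ((h.hasDerivAt_zero i p).mul (h'.hasDerivAt_zero i p)).deriv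
  simp only [Pi.mul_def, shift_zero, add_zero] at h1
  rw [StraightFilm.partialDeriv, h1]

theorem partialDeriv_mul_snd (h : IsTestFunction D φ) {G : ℝ → ℝ} (hG : ContDiff ℝ ∞ G)
    (i : Coord N) (p : Space N) : StraightFilm.partialDeriv i (fun p => G p.2 * φ p) p
      = G p.2 * StraightFilm.partialDeriv i φ p
        + (if i = Sum.inr () then deriv G p.2 * φ p else 0) := by
  have h1 : HasDerivAt (fun t : ℝ => G (p + shift i t).2)
      (if i = Sum.inr () then deriv G p.2 else 0) 0 := by
    rcases i with j | j
    · simpa [shift] using hasDerivAt_const (0 : ℝ) (G p.2)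
    · have h2 : HasDerivAt G (deriv G p.2) (p.2 + 0) := by
        simpa using (hG.differentiable (by simp) p.2).hasDerivAt
      simpa [shift] using h2.comp_const_add p.2 0
  have h3 := (h1.mul (h.hasDerivAt_zero i p)).deriv
  simp only [Pi.mul_def, shift_zero, add_zero] at h3
  rw [StraightFilm.partialDeriv, h3]
  split_ifs <;> ring

theorem memLp (h : IsTestFunction D φ) (q : ENNReal) : MemLp φ q (volume : Measure (Space N)) :=
  h.continuous.memLp_of_hasCompactSupport h.compact

theorem exists_bound (h : IsTestFunction D φ) : ∃ C, ∀ p, |φ p| ≤ C := by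
  simpa using h.continuous.bounded_above_of_compact_support h.compact

/-- By translation invariance of the measure, t ↦ ∫ θ(p) φ(p + t e_i) is constant, and its
derivative at 0 is the integral in question. The weight needs no smoothness, only invariance along
e_i, so it may be χ_Ω for the horizontal directions. -/
theorem integral_mul_partialDeriv_eq_zero (h : IsTestFunction D φ) (i : Coord N) {θ : Space N → ℝ}
    (hθ : Measurable θ) {C : ℝ} (hC : ∀ p, |θ p| ≤ C) (hinv : ∀ p t, θ (p + shift i t) = θ p) :
    ∫ p, θ p * StraightFilm.partialDeriv i φ p = 0 := by
  obtain ⟨B, hB⟩ := (h.partialDeriv i).exists_bound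
  obtain ⟨M, hM⟩ : ∃ M, ∀ p ∈ tsupport φ, |p.2| ≤ M := by
    simpa using h.compact.isCompact.exists_bound_of_continuousOn (f := Prod.snd)
      continuous_snd.continuousOn
  -- The extra 1 makes this slab contain the supports of all shifts of φ by |t| < 1, so its
  -- indicator dominates the difference quotients. The torus directions need no cutting since the
  -- torus is compact.
  set K : Set (Space N) := Prod.snd ⁻¹' Set.Icc (-(M + 1)) (M + 1) with hK
  have hKm : MeasurableSet K := measurableSet_Icc.preimage measurable_snd
  have hKfin : volume K ≠ ⊤ := by
    have : (volume : Measure (Space N)) K = volume (Set.Icc (-(M + 1)) (M + 1)) :=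
      measurePreserving_snd.measure_preimage measurableSet_Icc.nullMeasurableSet
    rw [this]; simp
  have hC0 : 0 ≤ C := (abs_nonneg _).trans (hC 0)
  have hB0 : 0 ≤ B := (abs_nonneg _).trans (hB 0)
  have hint : ∀ t, ∫ p, θ p * φ (p + shift i t) = ∫ p, θ p * φ p := by
    intro t
    rw [← integral_add_right_eq_self (fun p => θ p * φ p) (shift i t)]
    simp only [hinv]
  have hbound : ∀ p, ∀ t ∈ Metric.ball (0 : ℝ) 1,
      ‖θ p * StraightFilm.partialDeriv i φ (p + shift i t)‖ ≤ K.indicator (fun _ => C * B) p := by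
    intro p t ht
    by_cases hp : p ∈ K
    · rw [Set.indicator_of_mem hp, norm_mul]
      exact mul_le_mul (hC p) (hB _) (norm_nonneg _) hC0
    · have : p + shift i t ∉ tsupport φ := by
        intro hq
        apply hp
        have h1 := hM _ hq
        have h2 : |(shift i t : Space N).2| ≤ 1 := by
          rcases i with j | j
          · simp [shift]
          · simpa [shift] using (by simpa using ht : |t| < 1).le
        simp only [Prod.snd_add] at h1
        rw [hK, Set.mem_preimage, Set.mem_Icc]
        rw [abs_le] at h1 h2
        constructor <;> linarith
      rw [partialDeriv_eq_zero_of_notMem φ i this, mul_zero, norm_zero]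
      exact Set.indicator_nonneg (fun _ _ => mul_nonneg hC0 hB0) _
  have hcs : ∀ t, Continuous fun p : Space N => p + shift i t := fun t =>
    continuous_id.add continuous_const
  have hm : ∀ t, AEStronglyMeasurable (fun p => θ p * φ (p + shift i t)) volume := fun t =>
    (hθ.mul (h.continuous.comp (hcs t)).measurable).aestronglyMeasurable
  have key := hasDerivAt_integral_of_dominated_loc_of_deriv_le
    (μ := (volume : Measure (Space N))) (F := fun t p => θ p * φ (p + shift i t))
    (F' := fun t p => θ p * StraightFilm.partialDeriv i φ (p + shift i t))
    (x₀ := (0 : ℝ)) (Metric.ball_mem_nhds 0 one_pos) (Eventually.of_forall hm)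
    (bound := K.indicator fun _ => C * B)
    (by
      simp only [shift_zero, add_zero]
      exact (memLp_one_iff_integrable.1 (h.memLp 1)).bdd_mul hθ.aestronglyMeasurable
        (Eventually.of_forall hC))
    ((hθ.mul ((h.partialDeriv i).continuous.comp (hcs 0)).measurable).aestronglyMeasurable)
    (Eventually.of_forall hbound)
    ((integrableOn_const hKfin (C := C * B)).integrable_indicator hKm)
    (Eventually.of_forall fun p t _ => (h.hasDerivAt i p t).const_mul (θ p))
  have h1 := key.2
  simp only [hint, shift_zero, add_zero] at h1
  exact h1.unique (hasDerivAt_const _ _)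

theorem setIntegral_mul_partialDeriv (h : IsTestFunction D φ) (i : Coord N) (θ : Space N → ℝ) :
    ∫ p in D, θ p * StraightFilm.partialDeriv i φ p
      = ∫ p, θ p * StraightFilm.partialDeriv i φ p := by
  refine setIntegral_eq_integral_of_forall_compl_eq_zero fun p hp => ?_
  rw [partialDeriv_eq_zero_of_notMem φ i fun hq => hp (h.support hq), mul_zero]

theorem memH1 (h : IsTestFunction D φ) : MemH1 D φ (fun i => StraightFilm.partialDeriv i φ) where
  memLp := (h.memLp 2).restrict D
  grad_memLp i := ((h.partialDeriv i).memLp 2).restrict D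
  weak_deriv χ hχ i := by
    have h1 : ∫ p in D, (1 : ℝ) * StraightFilm.partialDeriv i (fun p => φ p * χ p) p = 0 := by
      rw [(h.mul hχ).setIntegral_mul_partialDeriv i fun _ => 1]
      exact (h.mul hχ).integral_mul_partialDeriv_eq_zero i measurable_const
        (C := 1) (by simp) (by simp)
    simp only [one_mul, h.partialDeriv_mul hχ] at h1
    rw [integral_add] at h1
    · linarith
    · exact (((h.partialDeriv i).memLp 2).restrict D).integrable_mul ((hχ.memLp 2).restrict D)
    · exact ((h.memLp 2).restrict D).integrable_mul (((hχ.partialDeriv i).memLp 2).restrict D)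

end IsTestFunction

end StraightFilm

namespace StraightFilm

/-! ### Limits in L². -/

section L2

variable {α : Type*} [MeasurableSpace α] {μ : Measure α}

theorem tendsto_integral_mul_of_tendsto_eLpNorm {f : ℕ → α → ℝ} {g h : α → ℝ}
    (hf : ∀ n, MemLp (f n) 2 μ) (hg : MemLp g 2 μ) (hh : MemLp h 2 μ)
    (hlim : Tendsto (fun n => eLpNorm (fun p => f n p - g p) 2 μ) atTop (𝓝 0)) :
    Tendsto (fun n => ∫ p, f n p * h p ∂μ) atTop (𝓝 (∫ p, g p * h p ∂μ)) := by
  refine tendsto_integral_of_L1' _ (hg.integrable_mul hh).aestronglyMeasurable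
    (Eventually.of_forall fun n => (hf n).integrable_mul hh) ?_
  have h1 : Tendsto (fun n => eLpNorm (fun p => f n p - g p) 2 μ * eLpNorm h 2 μ) atTop
      (𝓝 0) := by
    simpa using ENNReal.Tendsto.mul_const hlim (Or.inr hh.eLpNorm_ne_top)
  refine tendsto_of_tendsto_of_tendsto_of_le_of_le tendsto_const_nhds h1 (fun _ => zero_le)
    fun n => ?_
  have h2 := eLpNorm_smul_le_mul_eLpNorm (p := 2) (q := 2) (r := 1) (μ := μ) (f := h)
    hh.aestronglyMeasurable ((hf n).sub hg).aestronglyMeasurable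
  refine le_trans (le_of_eq ?_) h2
  congr 1
  ext p
  simp [sub_mul]

theorem tendsto_eLpNorm_mul_of_dominated {c : ℕ → α → ℝ} {f : α → ℝ} {C : ℝ}
    (hc : ∀ n, AEStronglyMeasurable (c n) μ) (hC : ∀ n p, |c n p| ≤ C) (hf : MemLp f 2 μ)
    (hlim : ∀ᵐ p ∂μ, Tendsto (fun n => c n p) atTop (𝓝 0)) :
    Tendsto (fun n => eLpNorm (fun p => c n p * f p) 2 μ) atTop (𝓝 0) := by
  have h1 : Tendsto (fun n => ∫⁻ p, ‖c n p * f p‖ₑ ^ (2 : ℝ) ∂μ) atTop (𝓝 (∫⁻ _, 0 ∂μ)) := by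
    refine tendsto_lintegral_of_dominated_convergence' (fun p => (‖C‖ₑ * ‖f p‖ₑ) ^ (2 : ℝ))
      (fun n => ((hc n).mul hf.aestronglyMeasurable).enorm.pow_const _) ?_ ?_ ?_
    · intro n
      refine Eventually.of_forall fun p => ?_
      simp only [enorm_mul]
      gcongr
      refine enorm_le_iff_norm_le.2 ?_
      rw [Real.norm_eq_abs, Real.norm_eq_abs]
      exact (hC n p).trans (le_abs_self C)
    · have h2 := (hf.const_mul C).eLpNorm_lt_top
      rw [eLpNorm_lt_top_iff_lintegral_rpow_enorm_lt_top (by simp) (by simp)] at h2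
      simpa [enorm_mul] using h2.ne
    · filter_upwards [hlim] with p hp
      have h3 : Tendsto (fun n => c n p * f p) atTop (𝓝 0) := by simpa using hp.mul_const (f p)
      have h4 := h3.enorm
      simpa using h4.ennrpow_const 2
  have h5 := h1.ennrpow_const (1 / 2)
  simp only [lintegral_zero] at h5
  rw [ENNReal.zero_rpow_of_pos (by norm_num)] at h5
  refine h5.congr fun n => ?_
  rw [eLpNorm_eq_lintegral_rpow_enorm_toReal (by simp) (by simp)]
  simp

/-- Split c_n f_n - d g = c_n (f_n - g) + (c_n - d) g: the first term is small because c_n is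
bounded, the second by dominated convergence. Pointwise convergence of the multipliers is enough,
which suits derivatives of Lipschitz functions. -/
theorem tendsto_eLpNorm_mul_sub_mul {c : ℕ → α → ℝ} {d : α → ℝ} {f : ℕ → α → ℝ} {g : α → ℝ}
    {C : ℝ} (hc : ∀ n, AEStronglyMeasurable (c n) μ) (hC : ∀ n p, |c n p| ≤ C)
    (hd : ∀ p, |d p| ≤ C) (hcd : ∀ᵐ p ∂μ, Tendsto (fun n => c n p) atTop (𝓝 (d p)))
    (hf : ∀ n, MemLp (f n) 2 μ) (hg : MemLp g 2 μ)
    (hlim : Tendsto (fun n => eLpNorm (fun p => f n p - g p) 2 μ) atTop (𝓝 0)) :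
    Tendsto (fun n => eLpNorm (fun p => c n p * f n p - d p * g p) 2 μ) atTop (𝓝 0) := by
  have hdm : AEStronglyMeasurable d μ := aestronglyMeasurable_of_tendsto_ae atTop hc hcd
  have h1 : Tendsto (fun n => ENNReal.ofReal C * eLpNorm (fun p => f n p - g p) 2 μ) atTop
      (𝓝 0) := by
    simpa using ENNReal.Tendsto.const_mul hlim (Or.inr ENNReal.ofReal_ne_top)
  have h2 := tendsto_eLpNorm_mul_of_dominated (μ := μ) (c := fun n p => c n p - d p) (f := g)
    (C := C + C) (fun n => (hc n).sub hdm)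
    (fun n p => (abs_sub _ _).trans (add_le_add (hC n p) (hd p))) hg
    (by
      filter_upwards [hcd] with p hp
      simpa using hp.sub_const (d p))
  have h3 := h1.add h2
  rw [add_zero] at h3
  refine tendsto_of_tendsto_of_tendsto_of_le_of_le tendsto_const_nhds h3 (fun _ => zero_le)
    fun n => ?_
  have h4 : (fun p => c n p * f n p - d p * g p)
      = (fun p => c n p * (f n p - g p)) + fun p => (c n p - d p) * g p := by
    ext p; simp only [Pi.add_apply]; ring
  rw [h4]
  refine (eLpNorm_add_le ((hc n).mul ((hf n).sub hg).aestronglyMeasurable)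
    (((hc n).sub hdm).mul hg.aestronglyMeasurable) (by norm_num)).trans ?_
  refine add_le_add
    (eLpNorm_le_mul_eLpNorm_of_ae_le_mul (Eventually.of_forall fun p => ?_) 2) le_rfl
  rw [Pi.mul_apply, norm_mul]
  exact mul_le_mul_of_nonneg_right (hC n p) (norm_nonneg _)

end L2

/-! ### Smooth approximation of bounded Lipschitz functions of one variable. -/

section Mollification

theorem abs_convolution_normed_le (ρ : ContDiffBump (0 : ℝ)) {f : ℝ → ℝ} {C : ℝ}
    (hC : ∀ y, |f y| ≤ C) (y : ℝ) :
    |convolution (ρ.normed volume) f (ContinuousLinearMap.lsmul ℝ ℝ) volume y| ≤ C := by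
  rw [convolution_def, ← Real.norm_eq_abs]
  have h1 : ∫ t, ρ.normed volume t * C = C := by
    rw [integral_mul_const, ρ.integral_normed, one_mul]
  rw [← h1]
  refine norm_integral_le_of_norm_le (ρ.integrable_normed.mul_const C)
    (Eventually.of_forall fun t => ?_)
  simp only [ContinuousLinearMap.lsmul_apply, smul_eq_mul, norm_mul]
  rw [Real.norm_of_nonneg (ρ.nonneg_normed t)]
  exact mul_le_mul_of_nonneg_left (hC _) (ρ.nonneg_normed t)

/-- The derivative is put on the Lipschitz factor, which is differentiable almost everywhere, so the
derivative of the mollification is an average of `deriv G` and inherits the bound K. -/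
theorem hasDerivAt_convolution_normed (ρ : ContDiffBump (0 : ℝ)) {G : ℝ → ℝ} {K : NNReal} {C : ℝ}
    (hL : LipschitzWith K G) (hC : ∀ y, |G y| ≤ C) (y : ℝ) :
    HasDerivAt (convolution (ρ.normed volume) G (ContinuousLinearMap.lsmul ℝ ℝ) volume)
      (convolution (ρ.normed volume) (deriv G) (ContinuousLinearMap.lsmul ℝ ℝ) volume y) y := by
  have hcont : ∀ z, Continuous fun t => G (z - t) := fun z =>
    hL.continuous.comp (continuous_const.sub continuous_id)
  have hρ : Continuous (ρ.normed volume) := ρ.continuous_normed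
  have hae : ∀ᵐ t : ℝ, DifferentiableAt ℝ G (y - t) := by
    exact (Measure.measurePreserving_sub_left (volume : Measure ℝ) y).quasiMeasurePreserving.ae
      hL.ae_differentiableAt_real
  refine (hasDerivAt_integral_of_dominated_loc_of_lip (s := Set.univ)
    (F := fun z t => ρ.normed volume t • G (z - t))
    (F' := fun t => ρ.normed volume t • deriv G (y - t))
    (bound := fun t => ρ.normed volume t * K) univ_mem
    (Eventually.of_forall fun z => (hρ.smul (hcont z)).aestronglyMeasurable) ?_ ?_ ?_ ?_ ?_).2
  · refine (ρ.integrable_normed (μ := volume)).mul_bdd (c := C) (hcont y).aestronglyMeasurable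
      (Eventually.of_forall fun t => hC _)
  · exact (hρ.measurable.smul ((measurable_deriv G).comp
      (measurable_const.sub measurable_id))).aestronglyMeasurable
  · refine Eventually.of_forall fun t => LipschitzOnWith.of_dist_le_mul fun u _ v _ => ?_
    have h1 := hL.dist_le_mul (u - t) (v - t)
    rw [dist_sub_right] at h1
    simp only [Real.coe_nnabs]
    rw [abs_of_nonneg (mul_nonneg (ρ.nonneg_normed t) K.coe_nonneg), dist_smul₀,
      Real.norm_of_nonneg (ρ.nonneg_normed t), mul_assoc]
    exact mul_le_mul_of_nonneg_left h1 (ρ.nonneg_normed t)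
  · exact ρ.integrable_normed.mul_const _
  · filter_upwards [hae] with t ht
    have h1 : HasDerivAt (fun z => G (z - t)) (deriv G (y - t)) y := by
      simpa using ht.hasDerivAt.comp_sub_const y t
    exact h1.const_mul _

theorem exists_smooth_approximation {G G' : ℝ → ℝ} {K : NNReal} {C : ℝ}
    (hL : LipschitzWith K G) (hC : ∀ y, |G y| ≤ C) (hd : ∀ᵐ y, HasDerivAt G (G' y) y) :
    ∃ H : ℕ → ℝ → ℝ, (∀ n, ContDiff ℝ ∞ (H n)) ∧ (∀ n y, |H n y| ≤ C) ∧
      (∀ n y, |deriv (H n) y| ≤ K) ∧ (∀ᵐ y, Tendsto (fun n => H n y) atTop (𝓝 (G y))) ∧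
      ∀ᵐ y, Tendsto (fun n => deriv (H n) y) atTop (𝓝 (G' y)) := by
  let ρ : ℕ → ContDiffBump (0 : ℝ) := fun n =>
    { rIn := 1 / ((n : ℝ) + 1)
      rOut := 2 * (1 / ((n : ℝ) + 1))
      rIn_pos := by positivity
      rIn_lt_rOut := by
        have : (0 : ℝ) < 1 / ((n : ℝ) + 1) := by positivity
        linarith }
  have hρ : Tendsto (fun n => (ρ n).rOut) atTop (𝓝 0) := by
    simpa [ρ] using (tendsto_one_div_add_atTop_nhds_zero_nat (𝕜 := ℝ)).const_mul 2
  -- The ratio of outer to inner radius must stay bounded for the Lebesgue differentiation theorem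
  -- to apply to these mollifiers; hence the choice of radii with ratio 2.
  have hK : ∀ᶠ n in atTop, (ρ n).rOut ≤ 2 * (ρ n).rIn := Eventually.of_forall fun n => le_rfl
  have hderiv : ∀ y, |deriv G y| ≤ K := fun y => norm_deriv_le_of_lipschitz hL
  have hloc : LocallyIntegrable (deriv G) volume := by
    refine (locallyIntegrable_const (K : ℝ)).mono (measurable_deriv G).aestronglyMeasurable ?_
    refine Eventually.of_forall fun y => ?_
    rw [Real.norm_of_nonneg K.coe_nonneg]
    exact hderiv y
  refine ⟨fun n => convolution ((ρ n).normed volume) G (ContinuousLinearMap.lsmul ℝ ℝ) volume,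
    fun n => ?_, fun n => abs_convolution_normed_le (ρ n) hC, fun n y => ?_, ?_, ?_⟩
  · exact (ρ n).hasCompactSupport_normed.contDiff_convolution_left _ (ρ n).contDiff_normed
      hL.continuous.locallyIntegrable
  · rw [(hasDerivAt_convolution_normed (ρ n) hL hC y).deriv]
    exact abs_convolution_normed_le (ρ n) hderiv y
  · exact ContDiffBump.ae_convolution_tendsto_right_of_locallyIntegrable hρ hK
      hL.continuous.locallyIntegrable
  · filter_upwards [hd, ContDiffBump.ae_convolution_tendsto_right_of_locallyIntegrable hρ hK hloc]
      with y hy h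
    simp only [(hasDerivAt_convolution_normed (ρ _) hL hC y).deriv]
    rwa [hy.deriv] at h

end Mollification

/-! ### The space H¹₀(D). -/

variable {N : ℕ} {D : Set (Space N)} {u v : Space N → ℝ} {g h : Coord N → Space N → ℝ}

/-- The weak derivative identity is continuous under L² limits, so only the approximation has to be
checked. -/
theorem memH10_of_approx {φ : ℕ → Space N → ℝ} (hu : MemLp u 2 (volume.restrict D))
    (hg : ∀ i, MemLp (g i) 2 (volume.restrict D)) (hφ : ∀ n, IsTestFunction D (φ n))
    (h0 : Tendsto (fun n => eLpNorm (fun p => φ n p - u p) 2 (volume.restrict D)) atTop (𝓝 0))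
    (h1 : ∀ i, Tendsto (fun n => eLpNorm (fun p => partialDeriv i (φ n) p - g i p) 2
      (volume.restrict D)) atTop (𝓝 0)) : MemH10 D u g where
  memLp := hu
  grad_memLp := hg
  approx := ⟨φ, hφ, h0, h1⟩
  weak_deriv χ hχ i := by
    have h2 := tendsto_integral_mul_of_tendsto_eLpNorm (fun n => (hφ n).memH1.memLp) hu
      (hχ.memH1.grad_memLp i) h0
    have h3 := (tendsto_integral_mul_of_tendsto_eLpNorm (fun n => (hφ n).memH1.grad_memLp i)
      (hg i) hχ.memH1.memLp (h1 i)).neg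
    simp only [(hφ _).memH1.weak_deriv χ hχ i] at h2
    exact tendsto_nhds_unique h2 h3

theorem IsTestFunction.memH10 {φ : Space N → ℝ} (h : IsTestFunction D φ) :
    MemH10 D φ (fun i => StraightFilm.partialDeriv i φ) :=
  memH10_of_approx (φ := fun _ => φ) h.memH1.memLp h.memH1.grad_memLp (fun _ => h) (by simp)
    (by simp)

namespace MemH10

theorem sub (hu : MemH10 D u g) (hv : MemH10 D v h) :
    MemH10 D (fun p => u p - v p) (fun i p => g i p - h i p) := by
  obtain ⟨φ, hφ, hφ0, hφ1⟩ := hu.approx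
  obtain ⟨χ, hχ, hχ0, hχ1⟩ := hv.approx
  have hsub : ∀ n, IsTestFunction D (fun p => φ n p - χ n p) := fun n =>
    { smooth := (hφ n).smooth.sub (hχ n).smooth
      compact := (hφ n).compact.sub (hχ n).compact
      support := (tsupport_sub _ _).trans
        (Set.union_subset (hφ n).support (hχ n).support) }
  have key : ∀ {a b : ℕ → Space N → ℝ} {a' b' : Space N → ℝ},
      (∀ n, MemLp (a n) 2 (volume.restrict D)) → (∀ n, MemLp (b n) 2 (volume.restrict D)) →
      MemLp a' 2 (volume.restrict D) → MemLp b' 2 (volume.restrict D) →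
      Tendsto (fun n => eLpNorm (fun p => a n p - a' p) 2 (volume.restrict D)) atTop (𝓝 0) →
      Tendsto (fun n => eLpNorm (fun p => b n p - b' p) 2 (volume.restrict D)) atTop (𝓝 0) →
      Tendsto (fun n => eLpNorm (fun p => (a n p - b n p) - (a' p - b' p)) 2
        (volume.restrict D)) atTop (𝓝 0) := by
    intro a b a' b' ha hb ha' hb' h1 h2
    have h3 := h1.add h2
    rw [add_zero] at h3
    refine tendsto_of_tendsto_of_tendsto_of_le_of_le tendsto_const_nhds h3 (fun _ => zero_le)
      fun n => ?_
    have h4 : (fun p => (a n p - b n p) - (a' p - b' p))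
        = (fun p => a n p - a' p) - fun p => b n p - b' p := by
      ext p; simp only [Pi.sub_apply]; ring
    rw [h4]
    exact eLpNorm_sub_le ((ha n).sub ha').aestronglyMeasurable
      ((hb n).sub hb').aestronglyMeasurable (by norm_num)
  refine memH10_of_approx (hu.memLp.sub hv.memLp)
    (fun i => (hu.grad_memLp i).sub (hv.grad_memLp i)) hsub
    (key (fun n => (hφ n).memH1.memLp) (fun n => (hχ n).memH1.memLp) hu.memLp hv.memLp hφ0 hχ0)
    fun i => ?_
  have hp : ∀ n p, partialDeriv i (fun p => φ n p - χ n p) p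
      = partialDeriv i (φ n) p - partialDeriv i (χ n) p := fun n p =>
    (((hφ n).hasDerivAt_zero i p).sub ((hχ n).hasDerivAt_zero i p)).deriv
  simp only [hp]
  exact key (fun n => (hφ n).memH1.grad_memLp i) (fun n => (hχ n).memH1.grad_memLp i)
    (hu.grad_memLp i) (hv.grad_memLp i) (hφ1 i) (hχ1 i)

/-- The divergence theorem for functions vanishing on ∂D. Finite measure of D puts the bounded
weight θ into L², so that the identity for test functions passes to the limit. -/
theorem integral_mul_grad_eq_zero [IsFiniteMeasure (volume.restrict D)] (hu : MemH10 D u g)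
    (i : Coord N) {θ : Space N → ℝ} (hθ : Measurable θ) {C : ℝ} (hC : ∀ p, |θ p| ≤ C)
    (hinv : ∀ p t, θ (p + shift i t) = θ p) : ∫ p in D, θ p * g i p = 0 := by
  obtain ⟨φ, hφ, -, hφ1⟩ := hu.approx
  have h1 := tendsto_integral_mul_of_tendsto_eLpNorm (fun n => (hφ n).memH1.grad_memLp i)
    (hu.grad_memLp i) (MemLp.of_bound hθ.aestronglyMeasurable C (Eventually.of_forall hC)) (hφ1 i)
  have h2 : ∀ n, ∫ p in D, partialDeriv i (φ n) p * θ p = 0 := fun n => by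
    simp only [mul_comm _ (θ _)]
    rw [(hφ n).setIntegral_mul_partialDeriv i θ]
    exact (hφ n).integral_mul_partialDeriv_eq_zero i hθ hC hinv
  simp only [h2] at h1
  simp only [mul_comm (θ _)]
  exact tendsto_nhds_unique h1 tendsto_const_nhds

/-- Only v is approximated by test functions φ_n. The weak derivative of u moves ∂_i onto ∂_jφ_n,
the two derivatives commute, and ∂_j is moved back. -/
theorem integral_grad_mul_grad_comm (hu : MemH10 D u g) (hv : MemH10 D v h) (i j : Coord N) :
    ∫ p in D, g i p * h j p = ∫ p in D, g j p * h i p := by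
  obtain ⟨φ, hφ, -, hφ1⟩ := hv.approx
  have h1 := tendsto_integral_mul_of_tendsto_eLpNorm (fun n => (hφ n).memH1.grad_memLp j)
    (hv.grad_memLp j) (hu.grad_memLp i) (hφ1 j)
  have h2 := tendsto_integral_mul_of_tendsto_eLpNorm (fun n => (hφ n).memH1.grad_memLp i)
    (hv.grad_memLp i) (hu.grad_memLp j) (hφ1 i)
  have h3 : ∀ n, ∫ p in D, partialDeriv j (φ n) p * g i p
      = ∫ p in D, partialDeriv i (φ n) p * g j p := fun n => by
    have h4 := hu.weak_deriv _ ((hφ n).partialDeriv j) i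
    have h5 := hu.weak_deriv _ ((hφ n).partialDeriv i) j
    simp only [(hφ n).partialDeriv_comm i j] at h4
    simp only [mul_comm (partialDeriv _ _ _)]
    linarith
  simp only [h3] at h1
  simp only [mul_comm (g _ _)]
  exact tendsto_nhds_unique h1 h2

theorem ae_snd {P : ℝ → Prop} (h : ∀ᵐ y, P y) : ∀ᵐ p : Space N ∂volume.restrict D, P p.2 :=
  ae_restrict_of_ae (Measure.quasiMeasurePreserving_snd.ae h)

/-- If φ_n approximates u and H_n is a mollification of G, the test functions H_n φ_n approximate G
u in H¹. This admits the piecewise smooth profiles below as multipliers. -/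
theorem mul_snd (hu : MemH10 D u g) {G G' : ℝ → ℝ} {K : NNReal} {C : ℝ}
    (hL : LipschitzWith K G) (hC : ∀ y, |G y| ≤ C) (hd : ∀ᵐ y, HasDerivAt G (G' y) y)
    (hG' : ∀ y, |G' y| ≤ K) :
    MemH10 D (fun p => G p.2 * u p)
      (fun i p => G p.2 * g i p + if i = Sum.inr () then G' p.2 * u p else 0) := by
  obtain ⟨φ, hφ, hφ0, hφ1⟩ := hu.approx
  obtain ⟨H, hs, hHC, hHK, hlim, hlim'⟩ := exists_smooth_approximation hL hC hd
  have hlim := ae_snd (D := D) hlim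
  have hlim' := ae_snd (D := D) hlim'
  have hm : ∀ n, AEStronglyMeasurable (fun p : Space N => H n p.2) (volume.restrict D) := fun n =>
    ((hs n).continuous.comp continuous_snd).aestronglyMeasurable
  have hm' : ∀ n, AEStronglyMeasurable (fun p : Space N => deriv (H n) p.2)
      (volume.restrict D) := fun n =>
    ((measurable_deriv _).comp measurable_snd).aestronglyMeasurable
  have hGm : AEStronglyMeasurable (fun p : Space N => G p.2) (volume.restrict D) :=
    (hL.continuous.comp continuous_snd).aestronglyMeasurable
  have hGm' : AEStronglyMeasurable (fun p : Space N => G' p.2) (volume.restrict D) :=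
    aestronglyMeasurable_of_tendsto_ae atTop hm' hlim'
  have hGu : ∀ {f : Space N → ℝ}, MemLp f 2 (volume.restrict D) →
      MemLp (fun p => G p.2 * f p) 2 (volume.restrict D) := fun hf =>
    hf.of_le_mul (c := C) (hGm.mul hf.aestronglyMeasurable) (Eventually.of_forall fun p => by
      rw [norm_mul]; exact mul_le_mul_of_nonneg_right (hC _) (norm_nonneg _))
  have hGu' : MemLp (fun p => G' p.2 * u p) 2 (volume.restrict D) :=
    hu.memLp.of_le_mul (c := K) (hGm'.mul hu.memLp.aestronglyMeasurable)
      (Eventually.of_forall fun p => by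
        rw [norm_mul]; exact mul_le_mul_of_nonneg_right (hG' _) (norm_nonneg _))
  have hφm : ∀ n, IsTestFunction D (fun p => H n p.2 * φ n p) := fun n => (hφ n).mul_snd (hs n)
  refine memH10_of_approx (hGu hu.memLp) (fun i => ?_) hφm ?_ fun i => ?_
  · refine (hGu (hu.grad_memLp i)).add ?_
    split_ifs
    · exact hGu'
    · exact MemLp.zero
  · exact tendsto_eLpNorm_mul_sub_mul hm (fun n p => hHC n _) (fun p => hC _) hlim
      (fun n => (hφ n).memH1.memLp) hu.memLp hφ0
  · have h1 := tendsto_eLpNorm_mul_sub_mul hm (fun n p => hHC n _) (fun p => hC _) hlim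
      (fun n => (hφ n).memH1.grad_memLp i) (hu.grad_memLp i) (hφ1 i)
    simp only [(hφ _).partialDeriv_mul_snd (hs _)]
    split_ifs
    · have h2 := tendsto_eLpNorm_mul_sub_mul hm' (fun n p => hHK n _) (fun p => hG' _) hlim'
        (fun n => (hφ n).memH1.memLp) hu.memLp hφ0
      have h3 := h1.add h2
      rw [add_zero] at h3
      refine tendsto_of_tendsto_of_tendsto_of_le_of_le tendsto_const_nhds h3 (fun _ => zero_le)
        fun n => ?_
      refine le_trans (le_of_eq ?_) (eLpNorm_add_le
        (((hm n).mul ((hφ n).memH1.grad_memLp i).aestronglyMeasurable).sub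
          (hGu (hu.grad_memLp i)).aestronglyMeasurable)
        (((hm' n).mul (hφ n).memH1.memLp.aestronglyMeasurable).sub
          hGu'.aestronglyMeasurable) (by norm_num))
      congr 1
      ext p
      simp only [Pi.add_apply]
      ring
    · simpa using h1

end MemH10

end StraightFilm

namespace StraightFilm

/-! ### One-dimensional profiles: distance to the film, exponential tail and sinh cutoff. -/

section Profiles

/-- The distance of `y` from the interval `[fl, fr]`. -/
noncomputable def filmDist (fl fr y : ℝ) : ℝ := max 0 (max (fl - y) (y - fr))

/-- The derivative of `filmDist`: the side of the interval `(fl, fr)` on which `y` lies. -/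
noncomputable def filmSide (fl fr y : ℝ) : ℝ := if y ≤ fl then -1 else if y < fr then 0 else 1

/-- The projection of `y` to `[fl, fr]`, relative to the midpoint. -/
noncomputable def filmProj (fl fr y : ℝ) : ℝ := max fl (min fr y) - (fl + fr) / 2

/-- The profile `exp (-dist (y, [fl, fr]) / k)`. -/
noncomputable def expProfile (fl fr k y : ℝ) : ℝ := Real.exp (-(filmDist fl fr y / k))

/-- The cutoff which is `1` on `[fl, fr]`, vanishes at distance `μ` from this interval and solves
`k² η'' = η` in between. -/
noncomputable def cutoff (fl fr k μ y : ℝ) : ℝ :=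
  Real.sinh (max 0 (μ - filmDist fl fr y) / k) / Real.sinh (μ / k)

/-- The derivative of `cutoff`. -/
noncomputable def cutoffDeriv (fl fr k μ y : ℝ) : ℝ :=
  if filmDist fl fr y < μ then
    -(filmSide fl fr y / k) * (Real.cosh ((μ - filmDist fl fr y) / k) / Real.sinh (μ / k))
  else 0

variable {fl fr k μ y : ℝ}

theorem filmDist_nonneg : 0 ≤ filmDist fl fr y := le_max_left _ _

theorem filmDist_of_le (hf : fl < fr) (h : y ≤ fl) : filmDist fl fr y = fl - y := by
  rw [filmDist, max_eq_left (by linarith : y - fr ≤ fl - y), max_eq_right (by linarith)]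

theorem filmDist_of_ge (hf : fl < fr) (h : fr ≤ y) : filmDist fl fr y = y - fr := by
  rw [filmDist, max_eq_right (by linarith : fl - y ≤ y - fr), max_eq_right (by linarith)]

theorem filmDist_of_mem (h : y ∈ Set.Icc fl fr) : filmDist fl fr y = 0 :=
  max_eq_left (max_le (by linarith [h.1]) (by linarith [h.2]))

theorem filmSide_of_le (h : y ≤ fl) : filmSide fl fr y = -1 := if_pos h

theorem filmSide_of_ge (hf : fl < fr) (h : fr ≤ y) : filmSide fl fr y = 1 := by
  rw [filmSide, if_neg (by linarith), if_neg (by linarith)]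

theorem filmSide_of_mem (h : y ∈ Set.Ioo fl fr) : filmSide fl fr y = 0 := by
  rw [filmSide, if_neg (by linarith [h.1]), if_pos h.2]

theorem filmProj_of_le (hf : fl < fr) (h : y ≤ fl) : filmProj fl fr y = -((fr - fl) / 2) := by
  rw [filmProj, min_eq_right (by linarith), max_eq_left h]; ring

theorem filmProj_of_ge (hf : fl < fr) (h : fr ≤ y) : filmProj fl fr y = (fr - fl) / 2 := by
  rw [filmProj, min_eq_left h, max_eq_right hf.le]; ring

theorem filmProj_of_mem (h : y ∈ Set.Icc fl fr) : filmProj fl fr y = y - (fl + fr) / 2 := by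
  rw [filmProj, min_eq_right h.2, max_eq_right h.1]

theorem side_cases (fl fr y : ℝ) : y ≤ fl ∨ fr ≤ y ∨ y ∈ Set.Ioo fl fr := by
  rcases le_or_gt y fl with h | h
  · exact Or.inl h
  · rcases le_or_gt fr y with h' | h'
    · exact Or.inr (Or.inl h')
    · exact Or.inr (Or.inr ⟨h, h'⟩)

theorem abs_filmSide_le : |filmSide fl fr y| ≤ 1 := by
  unfold filmSide; split_ifs <;> simp

theorem filmProj_mul_side (hf : fl < fr) :
    filmProj fl fr y * filmSide fl fr y = (fr - fl) / 2 * filmSide fl fr y ^ 2 := by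
  rcases side_cases fl fr y with h | h | h
  · rw [filmProj_of_le hf h, filmSide_of_le h]; ring
  · rw [filmProj_of_ge hf h, filmSide_of_ge hf h]; ring
  · rw [filmSide_of_mem h]; ring

theorem filmSide_pow_three (hf : fl < fr) : filmSide fl fr y ^ 3 = filmSide fl fr y := by
  rcases side_cases fl fr y with h | h | h
  · rw [filmSide_of_le h]; ring
  · rw [filmSide_of_ge hf h]; ring
  · rw [filmSide_of_mem h]; ring

theorem abs_filmProj_le (hf : fl < fr) : |filmProj fl fr y| ≤ (fr - fl) / 2 := by
  rcases side_cases fl fr y with h | h | h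
  · rw [filmProj_of_le hf h, abs_neg, abs_of_pos (by linarith)]
  · rw [filmProj_of_ge hf h, abs_of_pos (by linarith)]
  · rw [filmProj_of_mem ⟨h.1.le, h.2.le⟩, abs_le]
    constructor <;> linarith [h.1, h.2]

theorem ae_side_cases (fl fr : ℝ) : ∀ᵐ y : ℝ, y < fl ∨ fr < y ∨ y ∈ Set.Ioo fl fr := by
  filter_upwards [Measure.ae_ne volume fl, Measure.ae_ne volume fr] with y h1 h2
  rcases side_cases fl fr y with h | h | h
  · exact Or.inl (lt_of_le_of_ne h h1)
  · exact Or.inr (Or.inl (lt_of_le_of_ne h h2.symm))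
  · exact Or.inr (Or.inr h)

theorem hasDerivAt_filmDist (hf : fl < fr) : ∀ᵐ y,
    HasDerivAt (filmDist fl fr) (filmSide fl fr y) y := by
  filter_upwards [ae_side_cases fl fr] with y hy
  rcases hy with h | h | h
  · rw [filmSide_of_le h.le]
    refine ((hasDerivAt_id y).const_sub fl).congr_of_eventuallyEq ?_
    filter_upwards [Iio_mem_nhds h] with z hz using filmDist_of_le hf (le_of_lt hz)
  · rw [filmSide_of_ge hf h.le]
    refine ((hasDerivAt_id y).sub_const fr).congr_of_eventuallyEq ?_
    filter_upwards [Ioi_mem_nhds h] with z hz using filmDist_of_ge hf (le_of_lt hz)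
  · rw [filmSide_of_mem h]
    refine (hasDerivAt_const y (0 : ℝ)).congr_of_eventuallyEq ?_
    filter_upwards [Ioo_mem_nhds h.1 h.2] with z hz using filmDist_of_mem ⟨hz.1.le, hz.2.le⟩

theorem hasDerivAt_filmProj (hf : fl < fr) : ∀ᵐ y,
    HasDerivAt (filmProj fl fr) (1 - filmSide fl fr y ^ 2) y := by
  filter_upwards [ae_side_cases fl fr] with y hy
  rcases hy with h | h | h
  · rw [filmSide_of_le h.le]
    refine HasDerivAt.congr_of_eventuallyEq (f := fun _ => -((fr - fl) / 2)) ?_ ?_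
    · simpa using hasDerivAt_const y (-((fr - fl) / 2))
    · filter_upwards [Iio_mem_nhds h] with z hz using filmProj_of_le hf (le_of_lt hz)
  · rw [filmSide_of_ge hf h.le]
    refine HasDerivAt.congr_of_eventuallyEq (f := fun _ => (fr - fl) / 2) ?_ ?_
    · simpa using hasDerivAt_const y ((fr - fl) / 2)
    · filter_upwards [Ioi_mem_nhds h] with z hz using filmProj_of_ge hf (le_of_lt hz)
  · rw [filmSide_of_mem h]
    refine HasDerivAt.congr_of_eventuallyEq (f := fun z => z - (fl + fr) / 2) ?_ ?_
    · simpa using (hasDerivAt_id y).sub_const ((fl + fr) / 2)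
    · filter_upwards [Ioo_mem_nhds h.1 h.2] with z hz using filmProj_of_mem ⟨hz.1.le, hz.2.le⟩

theorem lipschitzWith_filmDist : LipschitzWith 1 (filmDist fl fr) := by
  have h1 : LipschitzWith 1 fun y : ℝ => fl - y :=
    LipschitzWith.of_dist_le_mul fun x y => by rw [dist_sub_left]; simp
  have h2 : LipschitzWith 1 fun y : ℝ => y - fr :=
    LipschitzWith.of_dist_le_mul fun x y => by simp
  have h3 := (h1.max h2).const_max 0
  rw [max_self] at h3
  exact h3

theorem lipschitzWith_filmProj : LipschitzWith 1 (filmProj fl fr) := by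
  have h1 : LipschitzWith 1 fun y : ℝ => max fl (min fr y) :=
    (LipschitzWith.id.const_min fr).const_max fl
  refine LipschitzWith.of_dist_le_mul fun x y => ?_
  simpa [filmProj] using h1.dist_le_mul x y

theorem measurable_filmSide : Measurable (filmSide fl fr) :=
  Measurable.ite measurableSet_Iic measurable_const
    (Measurable.ite measurableSet_Iio measurable_const measurable_const)

theorem lipschitzWith_comp_of_deriv_le {F F' g : ℝ → ℝ} {s : Set ℝ} {C : NNReal}
    (hs : Convex ℝ s) (hF : ∀ t, HasDerivAt F (F' t) t) (hC : ∀ t ∈ s, |F' t| ≤ C)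
    (hg : LipschitzWith 1 g) (hgs : ∀ y, g y ∈ s) : LipschitzWith C fun y => F (g y) := by
  refine LipschitzWith.of_dist_le_mul fun x y => ?_
  have h1 := hs.norm_image_sub_le_of_norm_hasDerivWithin_le
    (fun t _ => (hF t).hasDerivWithinAt) hC (hgs y) (hgs x)
  have h2 := hg.dist_le_mul x y
  simp only [NNReal.coe_one, one_mul] at h2
  rw [Real.dist_eq] at h2 ⊢
  exact h1.trans (mul_le_mul_of_nonneg_left h2 C.coe_nonneg)

theorem expProfile_pos : 0 < expProfile fl fr k y := Real.exp_pos _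

theorem abs_expProfile_le (hk : 0 < k) : |expProfile fl fr k y| ≤ 1 := by
  rw [abs_of_pos expProfile_pos, expProfile, Real.exp_le_one_iff, neg_nonpos]
  exact div_nonneg filmDist_nonneg hk.le

theorem lipschitzWith_expProfile (hk : 0 < k) :
    LipschitzWith (Real.toNNReal k⁻¹) (expProfile fl fr k) := by
  refine lipschitzWith_comp_of_deriv_le (F := fun t => Real.exp (-(t / k)))
    (F' := fun t => Real.exp (-(t / k)) * -(1 / k)) (convex_Ici (0 : ℝ)) (fun t => ?_)
    (fun t ht => ?_) lipschitzWith_filmDist fun y => filmDist_nonneg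
  · exact (((hasDerivAt_id t).div_const k).neg).exp
  · rw [Real.coe_toNNReal _ (inv_nonneg.2 hk.le), abs_mul, abs_neg, one_div,
      abs_of_pos (inv_pos.2 hk), Real.abs_exp]
    refine mul_le_of_le_one_left (inv_nonneg.2 hk.le) ?_
    rw [Real.exp_le_one_iff, neg_nonpos]
    exact div_nonneg ht hk.le

theorem hasDerivAt_expProfile (hf : fl < fr) : ∀ᵐ y,
    HasDerivAt (expProfile fl fr k) (-(filmSide fl fr y / k) * expProfile fl fr k y) y := by
  filter_upwards [hasDerivAt_filmDist hf] with y hy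
  have := ((hy.div_const k).neg).exp
  rw [mul_comm] at this
  exact this

theorem abs_deriv_expProfile_le (hk : 0 < k) :
    |(-(filmSide fl fr y / k) * expProfile fl fr k y)| ≤ Real.toNNReal k⁻¹ := by
  rw [Real.coe_toNNReal _ (inv_nonneg.2 hk.le), abs_mul, abs_neg, abs_div, abs_of_pos hk,
    div_eq_mul_inv]
  calc |filmSide fl fr y| * k⁻¹ * |expProfile fl fr k y| ≤ 1 * k⁻¹ * 1 := by
        gcongr
        · exact abs_filmSide_le
        · exact abs_expProfile_le hk
    _ = k⁻¹ := by ring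

theorem lipschitzWith_remaining : LipschitzWith 1 fun y => max 0 (μ - filmDist fl fr y) := by
  have h1 : LipschitzWith 1 fun y : ℝ => μ - filmDist fl fr y :=
    LipschitzWith.of_dist_le_mul fun x y => by
      rw [dist_sub_left]
      exact lipschitzWith_filmDist.dist_le_mul x y
  exact h1.const_max 0

theorem remaining_mem (hμ : 0 < μ) : max 0 (μ - filmDist fl fr y) ∈ Set.Icc 0 μ :=
  ⟨le_max_left _ _, max_le hμ.le (by linarith [filmDist_nonneg (fl := fl) (fr := fr) (y := y)])⟩

theorem sinh_pos (hk : 0 < k) (hμ : 0 < μ) : 0 < Real.sinh (μ / k) :=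
  Real.sinh_pos_iff.2 (div_pos hμ hk)

theorem abs_cutoff_le (hk : 0 < k) (hμ : 0 < μ) : |cutoff fl fr k μ y| ≤ 1 := by
  have h1 := remaining_mem (fl := fl) (fr := fr) (y := y) hμ
  have h2 := sinh_pos hk hμ
  rw [cutoff, abs_of_nonneg (div_nonneg (Real.sinh_nonneg_iff.2 (div_nonneg h1.1 hk.le)) h2.le),
    div_le_one h2, Real.sinh_le_sinh]
  exact div_le_div_of_nonneg_right h1.2 hk.le

/-- A Lipschitz constant of `cutoff`. -/
noncomputable def cutoffLip (k μ : ℝ) : NNReal :=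
  Real.toNNReal (Real.cosh (μ / k) * (1 / k) / Real.sinh (μ / k))

theorem coe_cutoffLip (hk : 0 < k) (hμ : 0 < μ) :
    (cutoffLip k μ : ℝ) = Real.cosh (μ / k) * (1 / k) / Real.sinh (μ / k) :=
  Real.coe_toNNReal _ (div_nonneg (mul_nonneg (Real.cosh_pos _).le (by positivity))
    (sinh_pos hk hμ).le)

theorem lipschitzWith_cutoff (hk : 0 < k) (hμ : 0 < μ) :
    LipschitzWith (cutoffLip k μ) (cutoff fl fr k μ) := by
  refine lipschitzWith_comp_of_deriv_le (F := fun t => Real.sinh (t / k) / Real.sinh (μ / k))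
    (F' := fun t => Real.cosh (t / k) * (1 / k) / Real.sinh (μ / k)) (convex_Icc (0 : ℝ) μ)
    (fun t => ?_) (fun t ht => ?_) lipschitzWith_remaining fun y => remaining_mem hμ
  · exact (((hasDerivAt_id t).div_const k).sinh).div_const _
  · have h2 := sinh_pos hk hμ
    rw [coe_cutoffLip hk hμ, abs_of_nonneg (div_nonneg (mul_nonneg (Real.cosh_pos _).le
      (by positivity)) h2.le)]
    gcongr
    rw [Real.cosh_le_cosh, abs_of_nonneg (div_nonneg ht.1 hk.le), abs_of_pos (div_pos hμ hk)]
    exact div_le_div_of_nonneg_right ht.2 hk.le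

theorem abs_cutoffDeriv_le (hk : 0 < k) (hμ : 0 < μ) :
    |cutoffDeriv fl fr k μ y| ≤ cutoffLip k μ := by
  rw [coe_cutoffLip hk hμ]
  have h2 := sinh_pos hk hμ
  have h3 := filmDist_nonneg (fl := fl) (fr := fr) (y := y)
  unfold cutoffDeriv
  split_ifs with h
  · rw [abs_mul, abs_neg, abs_div, abs_div, abs_of_pos hk, abs_of_pos h2,
      abs_of_pos (Real.cosh_pos _)]
    calc |filmSide fl fr y| / k * (Real.cosh ((μ - filmDist fl fr y) / k) / Real.sinh (μ / k))
        ≤ 1 / k * (Real.cosh (μ / k) / Real.sinh (μ / k)) := by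
          gcongr
          · exact abs_filmSide_le
          · rw [Real.cosh_le_cosh, abs_of_nonneg (div_nonneg (by linarith) hk.le),
              abs_of_pos (div_pos hμ hk)]
            exact div_le_div_of_nonneg_right (by linarith) hk.le
      _ = _ := by ring
  · rw [abs_zero]
    exact div_nonneg (mul_nonneg (Real.cosh_pos _).le (by positivity)) h2.le

theorem hasDerivAt_cutoff (hf : fl < fr) : ∀ᵐ y,
    HasDerivAt (cutoff fl fr k μ) (cutoffDeriv fl fr k μ y) y := by
  filter_upwards [hasDerivAt_filmDist hf, Measure.ae_ne volume (fl - μ),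
    Measure.ae_ne volume (fr + μ), ae_side_cases fl fr] with y hy h1 h2 h3
  have hc : ContinuousAt (filmDist fl fr) y := lipschitzWith_filmDist.continuous.continuousAt
  unfold cutoffDeriv
  split_ifs with h
  · have h4 : HasDerivAt (fun z => Real.sinh ((μ - filmDist fl fr z) / k) / Real.sinh (μ / k))
        (Real.cosh ((μ - filmDist fl fr y) / k) * (-filmSide fl fr y / k) / Real.sinh (μ / k)) y :=
      (((hy.const_sub μ).div_const k).sinh).div_const _
    have h5 := h4.congr_of_eventuallyEq (f₁ := cutoff fl fr k μ) (by
      filter_upwards [hc.eventually (gt_mem_nhds h)] with z hz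
      rw [cutoff, max_eq_right (by linarith)])
    refine h5.congr_deriv ?_
    ring
  -- The kinks at distance exactly μ were excluded when choosing y. As μ has no prescribed sign,
  -- there remain the degenerate cases μ = 0 and μ < 0, where the cutoff vanishes identically.
  · have h4 : μ < filmDist fl fr y ∨ (μ = 0 ∧ y ∈ Set.Ioo fl fr) ∨ μ < 0 := by
      have h6 := filmDist_nonneg (fl := fl) (fr := fr) (y := y)
      rcases lt_or_eq_of_le (not_lt.1 h) with h5 | h5
      · exact Or.inl h5
      · rcases h3 with h3 | h3 | h3
        · rw [filmDist_of_le hf h3.le] at h5; exact absurd (by linarith) h1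
        · rw [filmDist_of_ge hf h3.le] at h5; exact absurd (by linarith) h2
        · rw [filmDist_of_mem ⟨h3.1.le, h3.2.le⟩] at h5
          exact Or.inr (Or.inl ⟨h5, h3⟩)
    have h5 : ∀ᶠ z in 𝓝 y, μ ≤ filmDist fl fr z := by
      rcases h4 with h4 | h4 | h4
      · exact (hc.eventually (lt_mem_nhds h4)).mono fun z hz => le_of_lt hz
      · exact Eventually.of_forall fun z => h4.1.trans_le filmDist_nonneg
      · exact Eventually.of_forall fun z => h4.le.trans filmDist_nonneg
    refine (hasDerivAt_const y (0 : ℝ)).congr_of_eventuallyEq ?_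
    filter_upwards [h5] with z hz
    rw [cutoff, max_eq_left (by linarith)]
    simp

theorem cutoff_of_le (h : μ ≤ filmDist fl fr y) : cutoff fl fr k μ y = 0 := by
  rw [cutoff, max_eq_left (by linarith)]; simp

theorem cutoffDeriv_of_le (h : μ ≤ filmDist fl fr y) : cutoffDeriv fl fr k μ y = 0 :=
  if_neg (not_lt.2 h)

theorem cutoff_of_mem (hk : 0 < k) (hμ : 0 < μ) (h : y ∈ Set.Icc fl fr) :
    cutoff fl fr k μ y = 1 := by
  rw [cutoff, filmDist_of_mem h, sub_zero, max_eq_right hμ.le, div_self (sinh_pos hk hμ).ne']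

theorem cutoffDeriv_of_mem (h : y ∈ Set.Ioo fl fr) : cutoffDeriv fl fr k μ y = 0 := by
  rw [cutoffDeriv, filmSide_of_mem h]; simp

theorem expProfile_of_mem (h : y ∈ Set.Icc fl fr) : expProfile fl fr k y = 1 := by
  rw [expProfile, filmDist_of_mem h]; simp

/-- This is cosh² - sinh² = 1, and the reason for a sinh cutoff: the error k²η'² - η² made by
localising to η is the constant 1/sinh²(μ/k) outside the film as far as distance μ, and zero on it.
-/
theorem sq_mul_cutoffDeriv_sq_sub (hk : 0 < k) (hμ : 0 < μ) :
    k ^ 2 * cutoffDeriv fl fr k μ y ^ 2 - filmSide fl fr y ^ 2 * cutoff fl fr k μ y ^ 2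
      ≤ filmSide fl fr y ^ 2 / Real.sinh (μ / k) ^ 2 := by
  rcases le_or_gt μ (filmDist fl fr y) with h | h
  · rw [cutoff_of_le h, cutoffDeriv_of_le h]
    simp only [ne_eq, OfNat.ofNat_ne_zero, not_false_eq_true, zero_pow, mul_zero, sub_zero]
    positivity
  · rw [cutoff, cutoffDeriv, if_pos h, max_eq_right (by linarith)]
    refine le_of_eq ?_
    have h2 := sinh_pos hk hμ
    field_simp
    rw [Real.cosh_sq]
    ring

/-- The energy density of the cutoff outside the film. At distance exactly μ the convention
`cutoffDeriv = 0` makes the left side vanish, so this is only an inequality there. -/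
theorem sq_mul_cutoffDeriv_sq_add (hk : 0 < k) (hμ : 0 < μ) (h : filmDist fl fr y ≤ μ) :
    filmSide fl fr y ^ 2 * (k ^ 2 * cutoffDeriv fl fr k μ y ^ 2 + cutoff fl fr k μ y ^ 2)
      ≤ filmSide fl fr y ^ 2 * ((Real.cosh ((μ - filmDist fl fr y) / k) ^ 2
          + Real.sinh ((μ - filmDist fl fr y) / k) ^ 2) / Real.sinh (μ / k) ^ 2) := by
  have h2 := sinh_pos hk hμ
  rcases h.eq_or_lt with h | h
  · rw [cutoff_of_le h.ge, cutoffDeriv_of_le h.ge]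
    simp only [ne_eq, OfNat.ofNat_ne_zero, not_false_eq_true, zero_pow, mul_zero, add_zero]
    positivity
  · rw [cutoff, cutoffDeriv, if_pos h, max_eq_right (by linarith)]
    refine le_of_eq ?_
    field_simp
    have h3 : filmSide fl fr y ^ 2 = 0 ∨ filmSide fl fr y ^ 2 = 1 := by
      unfold filmSide; split_ifs <;> simp
    rcases h3 with h3 | h3 <;> rw [h3] <;> ring

end Profiles

end StraightFilm

namespace StraightFilm

variable {N : ℕ} {D : Set (Space N)} {fl fr k μ a : ℝ}

/-! ### Vector fields, the energy form and vertical fields. -/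

section Fields

/-- The vertical vector field with profile `V`. -/
def verticalField (V : ℝ → ℝ) (i : Coord N) (p : Space N) : ℝ :=
  if i = Sum.inr () then V p.2 else 0

/-- The Jacobian of a vertical vector field, `V'` being the derivative of its profile. -/
def verticalJacobian (V' : ℝ → ℝ) (i j : Coord N) (p : Space N) : ℝ :=
  if i = Sum.inr () then if j = Sum.inr () then V' p.2 else 0 else 0

/-- A vector field and a Jacobian, both square integrable on `D`. -/
structure IsL2Field (D : Set (Space N)) (u : Coord N → Space N → ℝ)
    (Du : Coord N → Coord N → Space N → ℝ) : Prop where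
  memLp : ∀ i, MemLp (u i) 2 (volume.restrict D)
  grad_memLp : ∀ i j, MemLp (Du i j) 2 (volume.restrict D)

theorem isL2Field_of_memH10 {u : Coord N → Space N → ℝ} {Du : Coord N → Coord N → Space N → ℝ}
    (h : ∀ i, MemH10 D (u i) (Du i)) : IsL2Field D u Du :=
  ⟨fun i => (h i).memLp, fun i j => (h i).grad_memLp j⟩

/-- The density of the energy form. -/
noncomputable def energyDensity (fl fr a : ℝ) (u : Coord N → Space N → ℝ)
    (Du : Coord N → Coord N → Space N → ℝ) (v : Coord N → Space N → ℝ)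
    (Dv : Coord N → Coord N → Space N → ℝ) (p : Space N) : ℝ :=
  a * (∑ i, ∑ j, Du i j p * Dv i j p) + filmSide fl fr p.2 ^ 2 * ∑ i, u i p * v i p

variable {u v : Coord N → Space N → ℝ} {Du Dv : Coord N → Coord N → Space N → ℝ}

namespace IsL2Field

theorem sub (hu : IsL2Field D u Du) (hv : IsL2Field D v Dv) :
    IsL2Field D (fun i p => u i p - v i p) (fun i j p => Du i j p - Dv i j p) :=
  ⟨fun i => (hu.memLp i).sub (hv.memLp i), fun i j => (hu.grad_memLp i j).sub (hv.grad_memLp i j)⟩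

theorem integrable_grad_mul (hu : IsL2Field D u Du) (hv : IsL2Field D v Dv) :
    IntegrableOn (fun p => ∑ i, ∑ j, Du i j p * Dv i j p) D :=
  integrable_finsetSum _ fun i _ => integrable_finsetSum _ fun j _ =>
    (hu.grad_memLp i j).integrable_mul (hv.grad_memLp i j)

theorem integrable_mul (hu : IsL2Field D u Du) (hv : IsL2Field D v Dv) :
    IntegrableOn (fun p => ∑ i, u i p * v i p) D :=
  integrable_finsetSum _ fun i _ => (hu.memLp i).integrable_mul (hv.memLp i)

theorem memLp_div (hu : IsL2Field D u Du) :
    MemLp (fun p => ∑ i, Du i i p) 2 (volume.restrict D) :=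
  memLp_finsetSum _ fun i _ => hu.grad_memLp i i

end IsL2Field

theorem measurable_side_snd : Measurable fun p : Space N => filmSide fl fr p.2 :=
  measurable_filmSide.comp measurable_snd

theorem abs_side_sq_le (y : ℝ) : |filmSide fl fr y ^ 2| ≤ 1 := by
  rw [abs_pow]; exact pow_le_one₀ (abs_nonneg _) abs_filmSide_le

theorem integrableOn_side_mul {f : Space N → ℝ} (hf : IntegrableOn f D) :
    IntegrableOn (fun p => filmSide fl fr p.2 ^ 2 * f p) D :=
  hf.bdd_mul (c := 1) (measurable_side_snd.pow_const 2).aestronglyMeasurable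
    (Eventually.of_forall fun p => abs_side_sq_le p.2)

theorem IsL2Field.integrable_energyDensity (hu : IsL2Field D u Du) (hv : IsL2Field D v Dv) :
    IntegrableOn (energyDensity fl fr a u Du v Dv) D :=
  ((hu.integrable_grad_mul hv).const_mul a).add (integrableOn_side_mul (hu.integrable_mul hv))

theorem measurableSet_film : MeasurableSet (film N fl fr) :=
  (measurableSet_lt measurable_const measurable_snd).inter
    (measurableSet_lt measurable_snd measurable_const)

theorem side_sq_of_mem {p : Space N} (hp : p ∈ film N fl fr) : filmSide fl fr p.2 ^ 2 = 0 := by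
  rw [filmSide_of_mem (show p.2 ∈ Set.Ioo fl fr from hp)]; norm_num

theorem side_sq_of_notMem (hf : fl < fr) {p : Space N} (hp : p ∉ film N fl fr) :
    filmSide fl fr p.2 ^ 2 = 1 := by
  rcases side_cases fl fr p.2 with h | h | h
  · rw [filmSide_of_le h]; norm_num
  · rw [filmSide_of_ge hf h]; norm_num
  · exact absurd h hp

/-- `filmSide²` serves as 1 - χ_Ω. All integrals then run over D alone, and pointwise identities
become polynomial identities in `filmSide`. -/
theorem setIntegral_diff_film (hf : fl < fr) (f : Space N → ℝ) :
    ∫ p in D \ film N fl fr, f p = ∫ p in D, filmSide fl fr p.2 ^ 2 * f p := by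
  rw [Set.sdiff_eq, ← setIntegral_indicator measurableSet_film.compl]
  congr 1
  ext p
  by_cases hp : p ∈ film N fl fr
  · rw [Set.indicator_of_notMem (by simpa using hp), side_sq_of_mem hp, zero_mul]
  · rw [Set.indicator_of_mem (by simpa using hp), side_sq_of_notMem hf hp, one_mul]

theorem setIntegral_film (hf : fl < fr) (hD : film N fl fr ⊆ D) (f : Space N → ℝ) :
    ∫ p in film N fl fr, f p = ∫ p in D, (1 - filmSide fl fr p.2 ^ 2) * f p := by
  rw [← Set.inter_eq_right.2 hD, ← setIntegral_indicator measurableSet_film]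
  congr 1
  ext p
  by_cases hp : p ∈ film N fl fr
  · rw [Set.indicator_of_mem hp, side_sq_of_mem hp, sub_zero, one_mul]
  · rw [Set.indicator_of_notMem hp, side_sq_of_notMem hf hp, sub_self, zero_mul]

theorem integral_energyDensity (hf : fl < fr) (hu : IsL2Field D u Du) (hv : IsL2Field D v Dv) :
    ∫ p in D, energyDensity fl fr a u Du v Dv p
      = a * (∫ p in D, ∑ i, ∑ j, Du i j p * Dv i j p)
        + ∫ p in D \ film N fl fr, ∑ i, u i p * v i p := by
  unfold energyDensity
  rw [setIntegral_diff_film hf, integral_add ((hu.integrable_grad_mul hv).const_mul a)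
    (integrableOn_side_mul (hu.integrable_mul hv)), integral_const_mul]

theorem energyDensity_sub_sub (p : Space N) :
    energyDensity fl fr a (fun i p => u i p - v i p) (fun i j p => Du i j p - Dv i j p)
        (fun i p => u i p - v i p) (fun i j p => Du i j p - Dv i j p) p
      = energyDensity fl fr a u Du u Du p - 2 * energyDensity fl fr a v Dv u Du p
        + energyDensity fl fr a v Dv v Dv p := by
  have h1 : ∑ i, ∑ j, (Du i j p - Dv i j p) * (Du i j p - Dv i j p)
      = (∑ i, ∑ j, Du i j p * Du i j p) - 2 * (∑ i, ∑ j, Dv i j p * Du i j p)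
        + ∑ i, ∑ j, Dv i j p * Dv i j p := by
    simp only [Finset.mul_sum, ← Finset.sum_sub_distrib, ← Finset.sum_add_distrib]
    exact Finset.sum_congr rfl fun i _ => Finset.sum_congr rfl fun j _ => by ring
  have h2 : ∑ i, (u i p - v i p) * (u i p - v i p)
      = (∑ i, u i p * u i p) - 2 * (∑ i, v i p * u i p) + ∑ i, v i p * v i p := by
    simp only [Finset.mul_sum, ← Finset.sum_sub_distrib, ← Finset.sum_add_distrib]
    exact Finset.sum_congr rfl fun i _ => by ring
  simp only [energyDensity, h1, h2]
  ring

theorem integral_energyDensity_sub_sub (hu : IsL2Field D u Du) (hv : IsL2Field D v Dv) :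
    ∫ p in D, energyDensity fl fr a (fun i p => u i p - v i p) (fun i j p => Du i j p - Dv i j p)
        (fun i p => u i p - v i p) (fun i j p => Du i j p - Dv i j p) p
      = (∫ p in D, energyDensity fl fr a u Du u Du p)
        - 2 * (∫ p in D, energyDensity fl fr a v Dv u Du p)
        + ∫ p in D, energyDensity fl fr a v Dv v Dv p := by
  simp only [energyDensity_sub_sub]
  rw [integral_add, integral_sub, integral_const_mul]
  · exact hu.integrable_energyDensity hu
  · exact (hv.integrable_energyDensity hu).const_mul 2
  · exact (hu.integrable_energyDensity hu).sub ((hv.integrable_energyDensity hu).const_mul 2)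
  · exact hv.integrable_energyDensity hv

theorem energyDensity_self_nonneg (ha : 0 ≤ a) (p : Space N) :
    0 ≤ energyDensity fl fr a u Du u Du p :=
  add_nonneg (mul_nonneg ha (Finset.sum_nonneg fun _ _ => Finset.sum_nonneg fun _ _ =>
    mul_self_nonneg _)) (mul_nonneg (sq_nonneg _) (Finset.sum_nonneg fun _ _ => mul_self_nonneg _))

/-- Exchanging derivatives gives ∫ ∂_i u_i ∂_j u_j = ∫ ∂_j u_i ∂_i u_j, and 2xy ≤ x² + y² finishes.
Cauchy–Schwarz on the pointwise trace would cost a factor N + 1. -/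
theorem integral_div_sq_le (hu : ∀ i, MemH10 D (u i) (Du i)) :
    ∫ p in D, (∑ i, Du i i p) ^ 2 ≤ ∫ p in D, ∑ i, ∑ j, Du i j p * Du i j p := by
  have hint : ∀ i j i' j', IntegrableOn (fun p => Du i j p * Du i' j' p) D := fun i j i' j' =>
    ((hu i).grad_memLp j).integrable_mul ((hu i').grad_memLp j')
  have h1 : ∫ p in D, (∑ i, Du i i p) ^ 2 = ∑ i, ∑ j, ∫ p in D, Du i j p * Du j i p := by
    simp only [sq, Finset.sum_mul_sum]
    rw [integral_finsetSum _ fun i _ => integrable_finsetSum _ fun j _ => hint i i j j]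
    refine Finset.sum_congr rfl fun i _ => ?_
    rw [integral_finsetSum _ fun j _ => hint i i j j]
    exact Finset.sum_congr rfl fun j _ => (hu i).integral_grad_mul_grad_comm (hu j) i j
  have h2 : ∫ p in D, ∑ i, ∑ j, Du i j p * Du i j p
      = ∑ i, ∑ j, ∫ p in D, Du i j p * Du i j p := by
    rw [integral_finsetSum _ fun i _ => integrable_finsetSum _ fun j _ => hint i j i j]
    exact Finset.sum_congr rfl fun i _ => integral_finsetSum _ fun j _ => hint i j i j
  have h3 : ∀ i j, ∫ p in D, Du i j p * Du j i p
      ≤ ((∫ p in D, Du i j p * Du i j p) + ∫ p in D, Du j i p * Du j i p) / 2 := fun i j => by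
    rw [← integral_add (hint i j i j) (hint j i j i), ← integral_div]
    refine integral_mono (hint i j j i) (((hint i j i j).add (hint j i j i)).div_const 2)
      fun p => ?_
    simp only
    nlinarith [sq_nonneg (Du i j p - Du j i p)]
  rw [h1, h2]
  refine (Finset.sum_le_sum fun i _ => Finset.sum_le_sum fun j _ => h3 i j).trans (le_of_eq ?_)
  simp only [← Finset.sum_div, Finset.sum_add_distrib]
  rw [Finset.sum_comm (f := fun i j => ∫ p in D, Du j i p * Du j i p)]
  ring

theorem sum_verticalField_mul (V : ℝ → ℝ) (f : Coord N → ℝ) (p : Space N) :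
    ∑ i, verticalField V i p * f i = V p.2 * f (Sum.inr ()) := by
  simp [verticalField]

theorem sum_verticalJacobian_mul (V' : ℝ → ℝ) (f : Coord N → Coord N → ℝ) (p : Space N) :
    ∑ i, ∑ j, verticalJacobian V' i j p * f i j = V' p.2 * f (Sum.inr ()) (Sum.inr ()) := by
  simp [verticalJacobian]

theorem sum_verticalJacobian_diag (V' : ℝ → ℝ) (p : Space N) :
    ∑ i, verticalJacobian V' i i p = V' p.2 := by
  simp [verticalJacobian]

theorem energyDensity_vertical (V V' : ℝ → ℝ) (p : Space N) :
    energyDensity fl fr a (verticalField V) (verticalJacobian V') u Du p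
      = a * (V' p.2 * Du (Sum.inr ()) (Sum.inr ()) p)
        + filmSide fl fr p.2 ^ 2 * (V p.2 * u (Sum.inr ()) p) := by
  rw [energyDensity, sum_verticalJacobian_mul V' (fun i j => Du i j p),
    sum_verticalField_mul V (fun i => u i p)]

theorem energyDensity_vertical_self (V V' : ℝ → ℝ) (p : Space N) :
    energyDensity fl fr a (verticalField V) (verticalJacobian V') (verticalField V)
      (verticalJacobian V') p = a * V' p.2 ^ 2 + filmSide fl fr p.2 ^ 2 * V p.2 ^ 2 := by
  rw [energyDensity_vertical]
  simp only [verticalField, verticalJacobian, if_true]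
  ring

theorem isL2Field_vertical [IsFiniteMeasure (volume.restrict D)] {V V' : ℝ → ℝ} {C : ℝ}
    (hV : Measurable V) (hV' : Measurable V') (hC : ∀ y, |V y| ≤ C) (hC' : ∀ y, |V' y| ≤ C) :
    IsL2Field D (verticalField V) (verticalJacobian V') := by
  have key : ∀ {W : ℝ → ℝ}, Measurable W → (∀ y, |W y| ≤ C) →
      MemLp (fun p : Space N => W p.2) 2 (volume.restrict D) := fun hW hWC =>
    MemLp.of_bound (hW.comp measurable_snd).aestronglyMeasurable C
      (Eventually.of_forall fun p => hWC p.2)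
  refine ⟨fun i => ?_, fun i j => ?_⟩
  · unfold verticalField
    split_ifs
    · exact key hV hC
    · exact MemLp.zero
  · unfold verticalJacobian
    split_ifs
    · exact key hV' hC'
    · exact MemLp.zero
    · exact MemLp.zero

/-- A vertical field in `H¹₀`. -/
def IsVerticalH10 (D : Set (Space N)) (V V' : ℝ → ℝ) : Prop :=
  ∀ i, MemH10 D (verticalField V i) (verticalJacobian V' i)

theorem memH10_zero : MemH10 D (fun _ => 0) (fun _ _ => 0) := by
  have h : IsTestFunction D (fun _ => 0) :=
    ⟨contDiff_const, HasCompactSupport.zero, by simp [tsupport]⟩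
  convert h.memH10 using 1
  ext i p
  simp [partialDeriv]

theorem isVerticalH10_of_memH10 {V V' : ℝ → ℝ}
    (h : MemH10 D (fun p => V p.2) (fun i p => if i = Sum.inr () then V' p.2 else 0)) :
    IsVerticalH10 D V V' := by
  intro i
  by_cases hi : i = Sum.inr ()
  · convert h using 1
    · ext p; simp only [verticalField, if_pos hi]
    · ext j p; simp only [verticalJacobian, if_pos hi]
  · convert memH10_zero using 1
    · ext p; simp only [verticalField, if_neg hi]
    · ext j p; simp only [verticalJacobian, if_neg hi]

theorem memH10_snd_mul {V V' G G' : ℝ → ℝ} {K : NNReal} {C : ℝ}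
    (h : MemH10 D (fun p => V p.2) (fun i p => if i = Sum.inr () then V' p.2 else 0))
    (hL : LipschitzWith K G) (hC : ∀ y, |G y| ≤ C) (hd : ∀ᵐ y, HasDerivAt G (G' y) y)
    (hG' : ∀ y, |G' y| ≤ K) :
    MemH10 D (fun p => G p.2 * V p.2)
      (fun i p => if i = Sum.inr () then G p.2 * V' p.2 + G' p.2 * V p.2 else 0) := by
  convert h.mul_snd hL hC hd hG' using 3 with i p
  split_ifs <;> simp

/-- The cutoff is only Lipschitz. It equals its product with a smooth bump `b` that is 1 where the
cutoff lives, and `b` is a test function on D; the gap μ < μ' leaves room for `b` to descend to zero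
inside D. -/
theorem memH10_cutoff (hf : fl < fr) (hk : 0 < k) (hμ : 0 < μ) {μ' : ℝ} (hμ' : μ < μ')
    (hD : ∀ p : Space N, fl - μ' ≤ p.2 → p.2 ≤ fr + μ' → p ∈ D) :
    MemH10 D (fun p => cutoff fl fr k μ p.2)
      (fun i p => if i = Sum.inr () then cutoffDeriv fl fr k μ p.2 else 0) := by
  let b : ContDiffBump ((fl + fr) / 2) :=
    { rIn := (fr - fl) / 2 + μ
      rOut := (fr - fl) / 2 + μ'
      rIn_pos := by linarith
      rIn_lt_rOut := by linarith }
  have hsub : Function.support (fun p : Space N => b p.2)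
      ⊆ Set.univ ×ˢ Metric.closedBall ((fl + fr) / 2) ((fr - fl) / 2 + μ') := by
    intro p hp
    have : p.2 ∈ Function.support b := hp
    rw [b.support_eq] at this
    exact ⟨trivial, Metric.ball_subset_closedBall this⟩
  have hcl : IsClosed ((Set.univ : Set (UnitAddTorus (Fin N))) ×ˢ
      Metric.closedBall ((fl + fr) / 2) ((fr - fl) / 2 + μ')) :=
    isClosed_univ.prod Metric.isClosed_closedBall
  have hb : IsTestFunction D (fun p => b p.2) :=
    { smooth := b.contDiff.comp contDiff_snd
      compact := HasCompactSupport.intro' (isCompact_univ.prod (isCompact_closedBall _ _)) hcl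
        fun p hp => by
          by_contra h
          exact hp (hsub h)
      support := (closure_minimal hsub hcl).trans fun p hp => by
        have h1 := hp.2
        rw [Metric.mem_closedBall, Real.dist_eq, abs_le] at h1
        exact hD p (by linarith) (by linarith) }
  have h1 := hb.memH10.mul_snd (lipschitzWith_cutoff (fl := fl) (fr := fr) hk hμ)
    (fun y => abs_cutoff_le hk hμ) (hasDerivAt_cutoff hf) (fun y => abs_cutoffDeriv_le hk hμ)
  have hone : ∀ y, filmDist fl fr y < μ → b =ᶠ[𝓝 y] 1 := by
    intro y hy
    refine b.eventuallyEq_one_of_mem_ball ?_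
    have h2 : fl - y ≤ filmDist fl fr y := (le_max_left _ _).trans (le_max_right _ _)
    have h3 : y - fr ≤ filmDist fl fr y := (le_max_right _ _).trans (le_max_right _ _)
    rw [Metric.mem_ball, Real.dist_eq, abs_lt]
    constructor
    · change -((fr - fl) / 2 + μ) < _; linarith
    · change _ < (fr - fl) / 2 + μ; linarith
  have hpd : ∀ i p, partialDeriv i (fun p : Space N => b p.2) p
      = if i = Sum.inr () then deriv b p.2 else 0 := by
    intro i p
    have h2 : HasDerivAt b (deriv b p.2) (p.2 + 0) := by
      simpa using (b.contDiff.differentiable (n := ∞) (by simp) p.2).hasDerivAt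
    rcases i with j | j
    · simp [partialDeriv, shift]
    · simpa [partialDeriv, shift] using (h2.comp_const_add p.2 0).deriv
  convert h1 using 2 with p i
  · rcases le_or_gt μ (filmDist fl fr p.2) with h | h
    · rw [cutoff_of_le h, zero_mul]
    · rw [(hone _ h).eq_of_nhds]; simp
  · ext p
    simp only [hpd]
    split_ifs
    · rcases le_or_gt μ (filmDist fl fr p.2) with h | h
      · rw [cutoff_of_le h, cutoffDeriv_of_le h]; ring
      · rw [(hone _ h).eq_of_nhds, (hone _ h).deriv_eq]
        simp
    · simp

end Fields

/-! ### Integrals of profiles over slabs. -/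

section SlabIntegrals

theorem intervalIntegral_profile (hf : fl < fr) {α M : ℝ} (hM : 0 ≤ M) {f : ℝ → ℝ}
    (hfc : Continuous f) :
    IntervalIntegrable (fun y => α * (1 - filmSide fl fr y ^ 2)
      + filmSide fl fr y ^ 2 * f (filmDist fl fr y)) volume (fl - M) (fr + M) ∧
    ∫ y in (fl - M)..(fr + M), (α * (1 - filmSide fl fr y ^ 2)
      + filmSide fl fr y ^ 2 * f (filmDist fl fr y))
      = α * (fr - fl) + 2 * ∫ t in (0 : ℝ)..M, f t := by
  set h : ℝ → ℝ := fun y => α * (1 - filmSide fl fr y ^ 2)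
      + filmSide fl fr y ^ 2 * f (filmDist fl fr y) with hh
  have e1 : Set.EqOn (fun y => f (fl - y)) h (Set.uIoo (fl - M) fl) := by
    intro y hy
    rw [Set.uIoo_of_le (by linarith)] at hy
    simp only [hh]
    rw [filmSide_of_le hy.2.le, filmDist_of_le hf hy.2.le]; ring
  have e2 : Set.EqOn (fun _ => α) h (Set.uIoo fl fr) := by
    intro y hy
    rw [Set.uIoo_of_le hf.le] at hy
    simp only [hh]
    rw [filmSide_of_mem hy]; ring
  have e3 : Set.EqOn (fun y => f (y - fr)) h (Set.uIoo fr (fr + M)) := by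
    intro y hy
    rw [Set.uIoo_of_le (by linarith)] at hy
    simp only [hh]
    rw [filmSide_of_ge hf hy.1.le, filmDist_of_ge hf hy.1.le]; ring
  have i1 : IntervalIntegrable h volume (fl - M) fl :=
    ((hfc.comp (continuous_const.sub continuous_id)).intervalIntegrable _ _).congr_uIoo e1
  have i2 : IntervalIntegrable h volume fl fr :=
    (continuous_const.intervalIntegrable _ _).congr_uIoo e2
  have i3 : IntervalIntegrable h volume fr (fr + M) :=
    ((hfc.comp (continuous_id.sub continuous_const)).intervalIntegrable _ _).congr_uIoo e3
  refine ⟨(i1.trans i2).trans i3, ?_⟩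
  rw [← intervalIntegral.integral_add_adjacent_intervals (i1.trans i2) i3,
    ← intervalIntegral.integral_add_adjacent_intervals i1 i2,
    ← intervalIntegral.integral_congr_uIoo e1, ← intervalIntegral.integral_congr_uIoo e2,
    ← intervalIntegral.integral_congr_uIoo e3, intervalIntegral.integral_comp_sub_left,
    intervalIntegral.integral_comp_sub_right, intervalIntegral.integral_const]
  simp only [sub_self, sub_sub_cancel, add_sub_cancel_left, smul_eq_mul]
  ring

/-- The torus has mass one, so `Prod.snd` preserves measure on slabs and the integral becomes
one-dimensional. Nonnegativity of the integrand allows S to be any part of the slab. -/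
theorem setIntegral_profile_le (hf : fl < fr) {α M : ℝ} (hα : 0 ≤ α) (hM : 0 ≤ M) {f : ℝ → ℝ}
    (hfc : Continuous f) (hf0 : ∀ t, 0 ≤ f t) {S : Set (Space N)}
    (hS : ∀ p ∈ S, fl - M < p.2 ∧ p.2 ≤ fr + M) :
    IntegrableOn (fun p => α * (1 - filmSide fl fr p.2 ^ 2)
      + filmSide fl fr p.2 ^ 2 * f (filmDist fl fr p.2)) S ∧
    ∫ p in S, (α * (1 - filmSide fl fr p.2 ^ 2)
      + filmSide fl fr p.2 ^ 2 * f (filmDist fl fr p.2))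
      ≤ α * (fr - fl) + 2 * ∫ t in (0 : ℝ)..M, f t := by
  obtain ⟨h1, h2⟩ := intervalIntegral_profile hf (α := α) hM hfc
  set h : ℝ → ℝ := fun y => α * (1 - filmSide fl fr y ^ 2)
      + filmSide fl fr y ^ 2 * f (filmDist fl fr y) with hh
  have hle : fl - M ≤ fr + M := by linarith
  rw [intervalIntegrable_iff_integrableOn_Ioc_of_le hle] at h1
  rw [intervalIntegral.integral_of_le hle] at h2
  have hmp : MeasurePreserving (Prod.snd : Space N → ℝ) := measurePreserving_snd
  have hmp' := hmp.restrict_preimage (measurableSet_Ioc (a := fl - M) (b := fr + M))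
  have hint : IntegrableOn (fun p : Space N => h p.2) (Prod.snd ⁻¹' Set.Ioc (fl - M) (fr + M)) :=
    hmp'.integrable_comp_of_integrable h1
  have heq : ∫ p in (Prod.snd : Space N → ℝ) ⁻¹' Set.Ioc (fl - M) (fr + M), h p.2
      = ∫ y in Set.Ioc (fl - M) (fr + M), h y := by
    rw [← hmp'.map_eq, integral_map hmp'.measurable.aemeasurable]
    rw [hmp'.map_eq]; exact h1.aestronglyMeasurable
  have hsub : S ⊆ Prod.snd ⁻¹' Set.Ioc (fl - M) (fr + M) := fun p hp => hS p hp
  refine ⟨hint.mono_set hsub, ?_⟩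
  rw [← h2, ← heq]
  refine setIntegral_mono_set hint (Eventually.of_forall fun p => ?_) hsub.eventuallyLE
  have h3 := abs_le.1 (abs_side_sq_le (fl := fl) (fr := fr) p.2)
  exact add_nonneg (mul_nonneg hα (by linarith)) (mul_nonneg (sq_nonneg _) (hf0 _))

theorem integral_exp_sq_le (hk : 0 < k) (M : ℝ) :
    ∫ t in (0 : ℝ)..M, Real.exp (-(t / k)) ^ 2 ≤ k / 2 := by
  have h1 : ∀ t ∈ Set.uIcc 0 M, HasDerivAt (fun t => -(k / 2) * Real.exp (-(t / k)) ^ 2)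
      (Real.exp (-(t / k)) ^ 2) t := by
    intro t _
    have h2 := (((((hasDerivAt_id t).div_const k).neg).exp).pow 2).const_mul (-(k / 2))
    refine h2.congr_deriv ?_
    simp only [id, Nat.cast_ofNat, Pi.neg_apply]
    field_simp
    norm_num
  rw [intervalIntegral.integral_eq_sub_of_hasDerivAt h1 (Continuous.intervalIntegrable
    (by fun_prop) _ _)]
  simp only [zero_div, neg_zero, Real.exp_zero, one_pow, mul_one]
  have : 0 ≤ k / 2 * Real.exp (-(M / k)) ^ 2 := by positivity
  linarith

theorem integral_cosh_sq_add_sinh_sq (hk : 0 < k) (μ : ℝ) :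
    ∫ t in (0 : ℝ)..μ, (Real.cosh ((μ - t) / k) ^ 2 + Real.sinh ((μ - t) / k) ^ 2)
      = k * (Real.sinh (μ / k) * Real.cosh (μ / k)) := by
  have h1 : ∀ t ∈ Set.uIcc 0 μ, HasDerivAt
      (fun t => -k * (Real.sinh ((μ - t) / k) * Real.cosh ((μ - t) / k)))
      (Real.cosh ((μ - t) / k) ^ 2 + Real.sinh ((μ - t) / k) ^ 2) t := by
    intro t _
    have h2 : HasDerivAt (fun t => (μ - t) / k) (-1 / k) t :=
      ((hasDerivAt_id t).const_sub μ).div_const k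
    refine ((h2.sinh.mul h2.cosh).const_mul (-k)).congr_deriv ?_
    field_simp
    ring
  rw [intervalIntegral.integral_eq_sub_of_hasDerivAt h1 (Continuous.intervalIntegrable
    (by fun_prop) _ _)]
  simp

end SlabIntegrals

end StraightFilm

namespace StraightFilm

/-! ### The explicit solution on the cylinder and its compactly supported competitor. -/

variable {N : ℕ} {D : Set (Space N)} {fl fr k μ μ' a A B M : ℝ}

/-- The profile of slope `B` on `[fl, fr]` cut off at distance `μ`. -/
noncomputable def cutProfile (fl fr k μ B y : ℝ) : ℝ :=
  B * filmProj fl fr y * cutoff fl fr k μ y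

/-- The derivative of `cutProfile`. -/
noncomputable def cutProfileDeriv (fl fr k μ B y : ℝ) : ℝ :=
  B * filmProj fl fr y * cutoffDeriv fl fr k μ y
    + B * (1 - filmSide fl fr y ^ 2) * cutoff fl fr k μ y

/-- The profile of slope `A` on `[fl, fr]` which decays exponentially outside. -/
noncomputable def freeProfile (fl fr k A y : ℝ) : ℝ :=
  A * filmProj fl fr y * expProfile fl fr k y

/-- The derivative of `freeProfile`. -/
noncomputable def freeProfileDeriv (fl fr k A y : ℝ) : ℝ :=
  A * filmProj fl fr y * (-(filmSide fl fr y / k) * expProfile fl fr k y)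
    + A * (1 - filmSide fl fr y ^ 2) * expProfile fl fr k y

theorem filmSide_sq_of_side (hf : fl < fr) {y : ℝ} (h : y ≤ fl ∨ fr ≤ y) :
    filmSide fl fr y ^ 2 = 1 := by
  rcases h with h | h
  · rw [filmSide_of_le h]; norm_num
  · rw [filmSide_of_ge hf h]; norm_num

theorem filmProj_sq_of_side (hf : fl < fr) {y : ℝ} (h : y ≤ fl ∨ fr ≤ y) :
    filmProj fl fr y ^ 2 = ((fr - fl) / 2) ^ 2 := by
  rcases h with h | h
  · rw [filmProj_of_le hf h, neg_sq]
  · rw [filmProj_of_ge hf h]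

theorem memH10_cutProfile (hf : fl < fr) (hk : 0 < k) (hμ : 0 < μ) (hμ' : μ < μ')
    (hD : ∀ p : Space N, fl - μ' ≤ p.2 → p.2 ≤ fr + μ' → p ∈ D) (B : ℝ) :
    MemH10 D (fun p => cutProfile fl fr k μ B p.2)
      (fun i p => if i = Sum.inr () then cutProfileDeriv fl fr k μ B p.2 else 0) := by
  have hL : LipschitzWith (Real.nnabs B) fun y => B * filmProj fl fr y :=
    LipschitzWith.of_dist_le_mul fun x y => by
      have h := lipschitzWith_filmProj (fl := fl) (fr := fr).dist_le_mul x y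
      rw [NNReal.coe_one, one_mul] at h
      rw [Real.coe_nnabs, Real.dist_eq, ← mul_sub, abs_mul, ← Real.dist_eq]
      exact mul_le_mul_of_nonneg_left h (abs_nonneg _)
  refine memH10_snd_mul (memH10_cutoff hf hk hμ hμ' hD) (C := |B| * ((fr - fl) / 2))
    (G' := fun y => B * (1 - filmSide fl fr y ^ 2)) hL (fun y => ?_) ?_ fun y => ?_
  · rw [abs_mul]
    exact mul_le_mul_of_nonneg_left (abs_filmProj_le hf) (abs_nonneg _)
  · filter_upwards [hasDerivAt_filmProj hf] with y hy using hy.const_mul B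
  · rw [abs_mul, Real.coe_nnabs]
    refine mul_le_of_le_one_right (abs_nonneg _) ?_
    have h := abs_le.1 (abs_side_sq_le (fl := fl) (fr := fr) y)
    rw [abs_le]
    constructor <;> nlinarith [sq_nonneg (filmSide fl fr y)]

theorem isVerticalH10_cutProfile (hf : fl < fr) (hk : 0 < k) (hμ : 0 < μ) (hμ' : μ < μ')
    (hD : ∀ p : Space N, fl - μ' ≤ p.2 → p.2 ≤ fr + μ' → p ∈ D) (B : ℝ) :
    IsVerticalH10 D (cutProfile fl fr k μ B) (cutProfileDeriv fl fr k μ B) :=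
  isVerticalH10_of_memH10 (memH10_cutProfile hf hk hμ hμ' hD B)

/-- This product is the cutoff times the free profile. The free profile itself need not vanish on
∂D, but its cutoff is admissible, as needed to localise s minus the free profile. -/
theorem isVerticalH10_expProfile_mul_cutProfile (hf : fl < fr) (hk : 0 < k) (hμ : 0 < μ)
    (hμ' : μ < μ') (hD : ∀ p : Space N, fl - μ' ≤ p.2 → p.2 ≤ fr + μ' → p ∈ D) (B : ℝ) :
    IsVerticalH10 D (fun y => expProfile fl fr k y * cutProfile fl fr k μ B y)
      (fun y => expProfile fl fr k y * cutProfileDeriv fl fr k μ B y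
        + -(filmSide fl fr y / k) * expProfile fl fr k y * cutProfile fl fr k μ B y) :=
  isVerticalH10_of_memH10 (memH10_snd_mul (memH10_cutProfile hf hk hμ hμ' hD B)
    (lipschitzWith_expProfile hk) (fun _ => abs_expProfile_le hk) (hasDerivAt_expProfile hf)
    fun _ => abs_deriv_expProfile_le hk)

theorem measurable_expProfile : Measurable (expProfile fl fr k) :=
  (Real.continuous_exp.comp
    (lipschitzWith_filmDist.continuous.div_const k).neg).measurable

theorem isL2Field_freeProfile [IsFiniteMeasure (volume.restrict D)] (hf : fl < fr) (hk : 0 < k)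
    (A : ℝ) : IsL2Field D (verticalField (freeProfile fl fr k A))
      (verticalJacobian (freeProfileDeriv fl fr k A)) := by
  have hm := (lipschitzWith_filmProj (fl := fl) (fr := fr)).continuous.measurable
  have hm' := measurable_filmSide (fl := fl) (fr := fr)
  have hE := measurable_expProfile (fl := fl) (fr := fr) (k := k)
  have h1 : ∀ y, |A * filmProj fl fr y| ≤ |A| * ((fr - fl) / 2) := fun y => by
    rw [abs_mul]; exact mul_le_mul_of_nonneg_left (abs_filmProj_le hf) (abs_nonneg _)
  have hT : 0 ≤ |A| * ((fr - fl) / 2) := (abs_nonneg _).trans (h1 0)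
  have h2 : ∀ y, |(-(filmSide fl fr y / k) * expProfile fl fr k y)| ≤ k⁻¹ := fun y => by
    have := abs_deriv_expProfile_le (fl := fl) (fr := fr) (y := y) hk
    rwa [Real.coe_toNNReal _ (inv_nonneg.2 hk.le)] at this
  refine isL2Field_vertical (C := |A| * ((fr - fl) / 2) * 1 + (|A| * ((fr - fl) / 2) * k⁻¹
    + |A| * 1 * 1)) ((measurable_const.mul hm).mul hE)
    (((measurable_const.mul hm).mul (((hm'.div_const k).neg).mul hE)).add
      ((measurable_const.mul (measurable_const.sub (hm'.pow_const 2))).mul hE))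
    (fun y => ?_) fun y => ?_
  · have h3 : |freeProfile fl fr k A y| ≤ |A| * ((fr - fl) / 2) * 1 := by
      rw [freeProfile, abs_mul]
      exact mul_le_mul (h1 y) (abs_expProfile_le hk) (abs_nonneg _) hT
    have : 0 ≤ |A| * ((fr - fl) / 2) * k⁻¹ + |A| * 1 * 1 := by positivity
    linarith
  · have h3 : |freeProfileDeriv fl fr k A y|
        ≤ |A| * ((fr - fl) / 2) * k⁻¹ + |A| * 1 * 1 := by
      rw [freeProfileDeriv]
      refine (abs_add_le _ _).trans (add_le_add ?_ ?_)
      · rw [abs_mul]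
        exact mul_le_mul (h1 y) (h2 y) (abs_nonneg _) hT
      · rw [abs_mul, abs_mul]
        have h := abs_le.1 (abs_side_sq_le (fl := fl) (fr := fr) y)
        have h4 : |1 - filmSide fl fr y ^ 2| ≤ 1 := by
          rw [abs_le]
          constructor <;> nlinarith [sq_nonneg (filmSide fl fr y)]
        exact mul_le_mul (mul_le_mul_of_nonneg_left h4 (abs_nonneg _)) (abs_expProfile_le hk)
          (abs_nonneg _) (by positivity)
    have : 0 ≤ |A| * ((fr - fl) / 2) * 1 := by linarith
    linarith

/-- Outside the film k²V'² = V², so the density is 2V² there. Over the whole cylinder the energy is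
A²T(k² + kT/2) = AT by the choice of A; restricting to D only loses part of the tails. -/
theorem integral_energyDensity_freeProfile_le (hf : fl < fr) (hk : 0 < k)
    (hA : A * (k ^ 2 + k * (fr - fl) / 2) = 1) (hM : 0 ≤ M)
    (hDM : ∀ p ∈ D, fl - M < p.2 ∧ p.2 ≤ fr + M) :
    ∫ p in D, energyDensity fl fr (k ^ 2) (verticalField (freeProfile fl fr k A))
      (verticalJacobian (freeProfileDeriv fl fr k A)) (verticalField (freeProfile fl fr k A))
      (verticalJacobian (freeProfileDeriv fl fr k A)) p ≤ A * (fr - fl) := by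
  obtain ⟨-, h2⟩ := setIntegral_profile_le hf (α := k ^ 2 * A ^ 2) (by positivity) hM
    (f := fun t => 2 * (A * ((fr - fl) / 2)) ^ 2 * Real.exp (-(t / k)) ^ 2) (by fun_prop)
    (fun t => by positivity) hDM
  have h3 : ∀ p : Space N, energyDensity fl fr (k ^ 2) (verticalField (freeProfile fl fr k A))
      (verticalJacobian (freeProfileDeriv fl fr k A)) (verticalField (freeProfile fl fr k A))
      (verticalJacobian (freeProfileDeriv fl fr k A)) p
      = k ^ 2 * A ^ 2 * (1 - filmSide fl fr p.2 ^ 2) + filmSide fl fr p.2 ^ 2 *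
        (2 * (A * ((fr - fl) / 2)) ^ 2 * Real.exp (-(filmDist fl fr p.2 / k)) ^ 2) := by
    intro p
    rw [energyDensity_vertical_self, ← expProfile]
    have h4 : p.2 ≤ fl ∨ fr ≤ p.2 ∨ p.2 ∈ Set.Ioo fl fr := side_cases fl fr p.2
    rw [← or_assoc] at h4
    rcases h4 with h4 | h4
    · have h5 := filmSide_sq_of_side hf h4
      have h6 := filmProj_sq_of_side hf h4
      simp only [freeProfile, freeProfileDeriv, h5, sub_self, mul_zero, zero_mul, add_zero,
        mul_pow, h6, neg_sq, div_pow]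
      field_simp
      ring
    · simp only [freeProfile, freeProfileDeriv, filmSide_of_mem h4,
        expProfile_of_mem (k := k) ⟨h4.1.le, h4.2.le⟩]
      ring
  simp only [h3]
  refine h2.trans ?_
  rw [intervalIntegral.integral_const_mul]
  have h5 := mul_le_mul_of_nonneg_left (integral_exp_sq_le hk M)
    (show 0 ≤ 2 * (A * ((fr - fl) / 2)) ^ 2 by positivity)
  have h6 : A * (fr - fl) = A * (fr - fl) * (A * (k ^ 2 + k * (fr - fl) / 2)) := by
    rw [hA, mul_one]
  rw [h6]
  nlinarith

theorem cutProfileDeriv_of_mem (hk : 0 < k) (hμ : 0 < μ) {y : ℝ} (h : y ∈ Set.Ioo fl fr) :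
    cutProfileDeriv fl fr k μ B y = B := by
  rw [cutProfileDeriv, cutoffDeriv_of_mem h, cutoff_of_mem hk hμ ⟨h.1.le, h.2.le⟩,
    filmSide_of_mem h]
  ring

/-- Compared with the free profile of slope B, truncation at distance μ replaces the tail factor k
by k coth(μ/k). -/
theorem integral_energyDensity_cutProfile_le (hDm : MeasurableSet D) (hf : fl < fr) (hk : 0 < k)
    (hμ : 0 < μ) (hμ' : μ < μ') (hD : ∀ p : Space N, fl - μ' ≤ p.2 → p.2 ≤ fr + μ' → p ∈ D)
    (B : ℝ) :
    ∫ p in D, energyDensity fl fr (k ^ 2) (verticalField (cutProfile fl fr k μ B))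
      (verticalJacobian (cutProfileDeriv fl fr k μ B)) (verticalField (cutProfile fl fr k μ B))
      (verticalJacobian (cutProfileDeriv fl fr k μ B)) p
      ≤ k ^ 2 * B ^ 2 * (fr - fl)
        + (B * (fr - fl)) ^ 2 / 2 * k * (Real.cosh (μ / k) / Real.sinh (μ / k)) := by
  have hs := sinh_pos hk hμ
  set S : Set (Space N) := D ∩ {p | fl - μ < p.2 ∧ p.2 ≤ fr + μ} with hS
  have hSD : S ⊆ D := Set.inter_subset_left
  obtain ⟨h1, h2⟩ := setIntegral_profile_le hf (α := k ^ 2 * B ^ 2) (M := μ) (by positivity) hμ.le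
    (f := fun t => (B * ((fr - fl) / 2)) ^ 2 * ((Real.cosh ((μ - t) / k) ^ 2
      + Real.sinh ((μ - t) / k) ^ 2) / Real.sinh (μ / k) ^ 2)) (by fun_prop)
    (fun t => by positivity) (S := S) fun p hp => hp.2
  have hv := isL2Field_of_memH10 (isVerticalH10_cutProfile hf hk hμ hμ' hD B)
  have hint := hv.integrable_energyDensity (fl := fl) (fr := fr) (a := k ^ 2) hv
  have hdist : ∀ p : Space N, filmDist fl fr p.2 < μ → fl - μ < p.2 ∧ p.2 ≤ fr + μ := by
    intro p hp
    have h3 : fl - p.2 ≤ filmDist fl fr p.2 := (le_max_left _ _).trans (le_max_right _ _)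
    have h4 : p.2 - fr ≤ filmDist fl fr p.2 := (le_max_right _ _).trans (le_max_right _ _)
    constructor <;> linarith
  rw [setIntegral_eq_of_subset_of_forall_sdiff_eq_zero hDm hSD]
  · refine (setIntegral_mono_on (hint.mono_set hSD) h1 (hDm.inter ?_) fun p hp => ?_).trans
      (h2.trans (le_of_eq ?_))
    · exact (measurableSet_lt measurable_const measurable_snd).inter
        (measurableSet_le measurable_snd measurable_const)
    · have hd : filmDist fl fr p.2 ≤ μ :=
        max_le hμ.le (max_le (by linarith [hp.2.1]) (by linarith [hp.2.2]))
      have h3 := sq_mul_cutoffDeriv_sq_add (fl := fl) (fr := fr) hk hμ hd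
      rw [energyDensity_vertical_self]
      have h4 : p.2 ≤ fl ∨ fr ≤ p.2 ∨ p.2 ∈ Set.Ioo fl fr := side_cases fl fr p.2
      rw [← or_assoc] at h4
      rcases h4 with h4 | h4
      · have h5 := filmSide_sq_of_side hf h4
        have h6 := filmProj_sq_of_side hf h4
        rw [h5, one_mul, one_mul] at h3
        have h7 := mul_le_mul_of_nonneg_left h3 (sq_nonneg (B * ((fr - fl) / 2)))
        simp only [cutProfile, cutProfileDeriv, h5, sub_self, mul_zero, zero_mul, add_zero,
          zero_add, one_mul]
        refine le_trans (le_of_eq ?_) h7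
        simp only [mul_pow, h6]
        ring
      · rw [cutProfileDeriv_of_mem hk hμ h4, filmSide_of_mem h4]
        refine le_of_eq ?_
        ring
    · rw [intervalIntegral.integral_const_mul, intervalIntegral.integral_div,
        integral_cosh_sq_add_sinh_sq hk]
      field_simp
  · intro p hp
    have h3 : μ ≤ filmDist fl fr p.2 := by
      by_contra h
      exact hp.2 ⟨hp.1, hdist p (not_le.1 h)⟩
    rw [energyDensity_vertical_self]
    simp [cutProfile, cutProfileDeriv, cutoff_of_le h3, cutoffDeriv_of_le h3]

theorem volume_film (N : ℕ) (fl fr : ℝ) : volume (film N fl fr) = ENNReal.ofReal (fr - fl) := by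
  have hmp : MeasurePreserving (Prod.snd : Space N → ℝ) := measurePreserving_snd
  have : film N fl fr = Prod.snd ⁻¹' Set.Ioo fl fr := rfl
  rw [this, hmp.measure_preimage measurableSet_Ioo.nullMeasurableSet, Real.volume_Ioo]

theorem film_subset (hμ' : 0 < μ') (hD : ∀ p : Space N, fl - μ' ≤ p.2 → p.2 ≤ fr + μ' → p ∈ D) :
    film N fl fr ⊆ D := fun p hp => hD p (by linarith [hp.1]) (by linarith [hp.2])

theorem integral_div_cutProfile (hf : fl < fr) (hk : 0 < k) (hμ : 0 < μ)
    (hD : film N fl fr ⊆ D) (B : ℝ) :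
    ∫ p in D, (1 - filmSide fl fr p.2 ^ 2)
      * ∑ i, verticalJacobian (cutProfileDeriv fl fr k μ B) i i p = B * (fr - fl) := by
  rw [← setIntegral_film hf hD]
  simp only [sum_verticalJacobian_diag]
  rw [setIntegral_congr_fun (g := fun _ => B) measurableSet_film fun p hp =>
    cutProfileDeriv_of_mem hk hμ hp]
  rw [setIntegral_const, measureReal_def, volume_film, ENNReal.toReal_ofReal (by linarith),
    smul_eq_mul, mul_comm]

/-- With e = e^{-dist/k} and γ = -kAT/2, the free profile V satisfies k²V' = χ_Ω + γe and (1 - χ_Ω)V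
= γe' almost everywhere. The density is therefore γ ∂_y(e u_y) + χ_Ω ∂_y u_y, whose first term
integrates to zero because u vanishes on ∂D. -/
theorem integral_energyDensity_freeProfile [IsFiniteMeasure (volume.restrict D)] (hf : fl < fr)
    (hk : 0 < k) (hA : A * (k ^ 2 + k * (fr - fl) / 2) = 1) {u : Coord N → Space N → ℝ}
    {Du : Coord N → Coord N → Space N → ℝ} (hu : ∀ i, MemH10 D (u i) (Du i)) :
    ∫ p in D, energyDensity fl fr (k ^ 2) (verticalField (freeProfile fl fr k A))
      (verticalJacobian (freeProfileDeriv fl fr k A)) u Du p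
      = ∫ p in D, (1 - filmSide fl fr p.2 ^ 2) * ∑ i, Du i i p := by
  set y₀ : Coord N := Sum.inr () with hy₀
  set γ : ℝ := -(k * A * ((fr - fl) / 2)) with hγ
  have h1 := (hu y₀).mul_snd (lipschitzWith_expProfile (fl := fl) (fr := fr) hk)
    (fun _ => abs_expProfile_le hk) (hasDerivAt_expProfile hf) fun _ => abs_deriv_expProfile_le hk
  have h2 := h1.integral_mul_grad_eq_zero y₀ (θ := fun _ => γ) measurable_const (C := |γ|)
    (fun _ => le_rfl) fun _ _ => rfl
  -- χ_Ω depends on y only, so the horizontal part of the divergence contributes nothing.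
  have h3 : ∀ j : Fin N, ∫ p in D, (1 - filmSide fl fr p.2 ^ 2) * Du (Sum.inl j) (Sum.inl j) p
      = 0 := fun j => (hu (Sum.inl j)).integral_mul_grad_eq_zero (Sum.inl j)
    (measurable_const.sub (measurable_side_snd.pow_const 2)) (C := 1)
    (fun p => by
      have h := abs_le.1 (abs_side_sq_le (fl := fl) (fr := fr) p.2)
      rw [abs_le]
      constructor <;> nlinarith [sq_nonneg (filmSide fl fr p.2)])
    fun p t => by simp [shift]
  have hone : ∀ i, IntegrableOn (fun p => (1 - filmSide fl fr p.2 ^ 2) * Du i i p) D := by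
    intro i
    have h4 := ((hu i).grad_memLp i).integrable (by norm_num)
    simp only [sub_mul, one_mul]
    exact h4.sub (integrableOn_side_mul h4)
  have h4 : ∀ p, energyDensity fl fr (k ^ 2) (verticalField (freeProfile fl fr k A))
      (verticalJacobian (freeProfileDeriv fl fr k A)) u Du p
      = γ * (expProfile fl fr k p.2 * Du y₀ y₀ p
          + if y₀ = Sum.inr () then -(filmSide fl fr p.2 / k) * expProfile fl fr k p.2 * u y₀ p
            else 0) + (1 - filmSide fl fr p.2 ^ 2) * Du y₀ y₀ p := by
    intro p
    rw [energyDensity_vertical, if_pos rfl, ← hy₀]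
    have h5 : freeProfileDeriv fl fr k A p.2 * k ^ 2
        = (1 - filmSide fl fr p.2 ^ 2) + γ * expProfile fl fr k p.2 := by
      have h6 : p.2 ≤ fl ∨ fr ≤ p.2 ∨ p.2 ∈ Set.Ioo fl fr := side_cases fl fr p.2
      rw [← or_assoc] at h6
      rcases h6 with h6 | h6
      · have h7 := filmProj_mul_side (y := p.2) hf
        have h8 := filmSide_sq_of_side hf h6
        rw [freeProfileDeriv, h8, hγ]
        rw [h8] at h7
        field_simp
        linear_combination (-(A * k * 2 * expProfile fl fr k p.2)) * h7
      -- On the film the identity reads k²A = 1 - kAT/2, which is what fixes A.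
      · rw [freeProfileDeriv, filmSide_of_mem h6, expProfile_of_mem ⟨h6.1.le, h6.2.le⟩, hγ]
        linear_combination hA
    have h6 : filmSide fl fr p.2 ^ 2 * freeProfile fl fr k A p.2
        = γ * (-(filmSide fl fr p.2 / k) * expProfile fl fr k p.2) := by
      have h7 := filmProj_mul_side (y := p.2) hf
      have h8 := filmSide_pow_three (y := p.2) hf
      rw [freeProfile, hγ]
      field_simp
      linear_combination (A * expProfile fl fr k p.2) *
        ((2 * filmSide fl fr p.2) * h7 + (fr - fl) * h8)
    linear_combination Du y₀ y₀ p * h5 + u y₀ p * h6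
  have h5 : ∀ p, (1 - filmSide fl fr p.2 ^ 2) * ∑ i, Du i i p
      = (∑ j : Fin N, (1 - filmSide fl fr p.2 ^ 2) * Du (Sum.inl j) (Sum.inl j) p)
        + (1 - filmSide fl fr p.2 ^ 2) * Du y₀ y₀ p := by
    intro p
    rw [Fintype.sum_sum_type, ← Finset.mul_sum]
    simp [hy₀, mul_add]
  simp only [h4, h5]
  rw [integral_add, integral_add, h2, integral_finsetSum _ fun j _ => hone (Sum.inl j)]
  · simp only [h3, Finset.sum_const_zero]
  · exact integrable_finsetSum _ fun j _ => hone (Sum.inl j)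
  · exact hone y₀
  · exact (((h1.grad_memLp y₀).integrable (by norm_num)).const_mul γ)
  · exact hone y₀

/-! ### Energy comparison of the weak solution with the explicit fields. -/

section WeakSolution

variable {s : Coord N → Space N → ℝ} {Ds : Coord N → Coord N → Space N → ℝ}

theorem IsWeakSolution.integral_energyDensity (h : IsWeakSolution D (film N fl fr) a s Ds)
    (hf : fl < fr) (hD : film N fl fr ⊆ D) {u : Coord N → Space N → ℝ}
    {Du : Coord N → Coord N → Space N → ℝ} (hu : ∀ i, MemH10 D (u i) (Du i)) :
    ∫ p in D, energyDensity fl fr a s Ds u Du p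
      = ∫ p in D, (1 - filmSide fl fr p.2 ^ 2) * ∑ i, Du i i p := by
  rw [StraightFilm.integral_energyDensity hf (isL2Field_of_memH10 h.memH10)
    (isL2Field_of_memH10 hu), h.weak_form u Du hu, setIntegral_film hf hD]

theorem energyDensity_comm {u v : Coord N → Space N → ℝ}
    {Du Dv : Coord N → Coord N → Space N → ℝ} (p : Space N) :
    energyDensity fl fr a u Du v Dv p = energyDensity fl fr a v Dv u Du p := by
  simp only [energyDensity, mul_comm (Du _ _ _), mul_comm (u _ _)]

/-- Testing both equations with s gives E(s,s) = L(s) = E(V,s), so E(s-V,s-V) = E(V,V) - L(s). -/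
theorem IsWeakSolution.energy_sub_freeProfile_le [IsFiniteMeasure (volume.restrict D)]
    (h : IsWeakSolution D (film N fl fr) (k ^ 2) s Ds) (hf : fl < fr) (hk : 0 < k)
    (hD : film N fl fr ⊆ D) (hA : A * (k ^ 2 + k * (fr - fl) / 2) = 1) (hM : 0 ≤ M)
    (hDM : ∀ p ∈ D, fl - M < p.2 ∧ p.2 ≤ fr + M) :
    ∫ p in D, energyDensity fl fr (k ^ 2)
      (fun i p => s i p - verticalField (freeProfile fl fr k A) i p)
      (fun i j p => Ds i j p - verticalJacobian (freeProfileDeriv fl fr k A) i j p)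
      (fun i p => s i p - verticalField (freeProfile fl fr k A) i p)
      (fun i j p => Ds i j p - verticalJacobian (freeProfileDeriv fl fr k A) i j p) p
      ≤ A * (fr - fl) - ∫ p in D, (1 - filmSide fl fr p.2 ^ 2) * ∑ i, Ds i i p := by
  rw [integral_energyDensity_sub_sub (isL2Field_of_memH10 h.memH10)
    (isL2Field_freeProfile hf hk A), h.integral_energyDensity hf hD h.memH10,
    integral_energyDensity_freeProfile hf hk hA h.memH10]
  linarith [integral_energyDensity_freeProfile_le hf hk hA hM hDM]

/-- Here E(s-C,s-C) = L(s) - 2L(C) + E(C,C), with L(C) = BT. L(s) enters with the sign opposite to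
that in `IsWeakSolution.energy_sub_freeProfile_le`, so it cancels in the sum. -/
theorem IsWeakSolution.energy_sub_cutProfile_le (h : IsWeakSolution D (film N fl fr) (k ^ 2) s Ds)
    (hDm : MeasurableSet D) (hf : fl < fr) (hk : 0 < k) (hμ : 0 < μ) (hμ' : μ < μ')
    (hD : ∀ p : Space N, fl - μ' ≤ p.2 → p.2 ≤ fr + μ' → p ∈ D) (B : ℝ) :
    ∫ p in D, energyDensity fl fr (k ^ 2)
      (fun i p => s i p - verticalField (cutProfile fl fr k μ B) i p)
      (fun i j p => Ds i j p - verticalJacobian (cutProfileDeriv fl fr k μ B) i j p)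
      (fun i p => s i p - verticalField (cutProfile fl fr k μ B) i p)
      (fun i j p => Ds i j p - verticalJacobian (cutProfileDeriv fl fr k μ B) i j p) p
      ≤ (∫ p in D, (1 - filmSide fl fr p.2 ^ 2) * ∑ i, Ds i i p) - 2 * (B * (fr - fl))
        + (k ^ 2 * B ^ 2 * (fr - fl)
          + (B * (fr - fl)) ^ 2 / 2 * k * (Real.cosh (μ / k) / Real.sinh (μ / k))) := by
  have hv := isVerticalH10_cutProfile hf hk hμ hμ' hD B
  have hfD := film_subset (hμ.trans hμ') hD
  have h1 := h.integral_energyDensity hf hfD hv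
  simp only [energyDensity_comm (u := s)] at h1
  rw [integral_energyDensity_sub_sub (isL2Field_of_memH10 h.memH10) (isL2Field_of_memH10 hv),
    h.integral_energyDensity hf hfD h.memH10, h1, integral_div_cutProfile hf hk hμ hfD]
  linarith [integral_energyDensity_cutProfile_le hDm hf hk hμ hμ' hD B]

theorem integral_film_div_sq_le {z : Coord N → Space N → ℝ}
    {Dz : Coord N → Coord N → Space N → ℝ} (hz : ∀ i, MemH10 D (z i) (Dz i))
    (hD : film N fl fr ⊆ D) :
    ∫ p in film N fl fr, (∑ i, Dz i i p) ^ 2 ≤ ∫ p in D, ∑ i, ∑ j, Dz i j p * Dz i j p :=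
  (setIntegral_mono_set (isL2Field_of_memH10 hz).memLp_div.integrable_sq
    (Eventually.of_forall fun _ => sq_nonneg _) hD.eventuallyLE).trans (integral_div_sq_le hz)

theorem integral_grad_sq_le_energy {z : Coord N → Space N → ℝ}
    {Dz : Coord N → Coord N → Space N → ℝ} (hz : IsL2Field D z Dz) :
    a * ∫ p in D, ∑ i, ∑ j, Dz i j p * Dz i j p
      ≤ ∫ p in D, energyDensity fl fr a z Dz z Dz p := by
  rw [← integral_const_mul]
  refine integral_mono ((hz.integrable_grad_mul hz).const_mul a)
    (hz.integrable_energyDensity hz) fun p => ?_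
  exact le_add_of_nonneg_right
    (mul_nonneg (sq_nonneg _) (Finset.sum_nonneg fun _ _ => mul_self_nonneg _))

/-- Slope B = A makes the competitor have divergence exactly A on the film. In the sum of the two
energy bounds everything cancels but the excess (AT)²(k/2)(coth(μ/k) - 1) of the truncated tail; the
energy of s - V is discarded. -/
theorem IsWeakSolution.integral_film_div_sub_sq_le_of_cutProfile
    [IsFiniteMeasure (volume.restrict D)] (h : IsWeakSolution D (film N fl fr) (k ^ 2) s Ds)
    (hDm : MeasurableSet D) (hf : fl < fr) (hk : 0 < k) (hμ : 0 < μ) (hμ' : μ < μ')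
    (hD : ∀ p : Space N, fl - μ' ≤ p.2 → p.2 ≤ fr + μ' → p ∈ D)
    (hA : A * (k ^ 2 + k * (fr - fl) / 2) = 1) (hM : 0 ≤ M)
    (hDM : ∀ p ∈ D, fl - M < p.2 ∧ p.2 ≤ fr + M) :
    k ^ 2 * ∫ p in film N fl fr, ((∑ i, Ds i i p) - A) ^ 2
      ≤ 2 / k * (Real.cosh (μ / k) / Real.sinh (μ / k) - 1) := by
  have hfD := film_subset (hμ.trans hμ') hD
  have hz := fun i => (h.memH10 i).sub (isVerticalH10_cutProfile hf hk hμ hμ' hD A i)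
  have h1 := integral_film_div_sq_le (fl := fl) (fr := fr) hz hfD
  have h2 := integral_grad_sq_le_energy (fl := fl) (fr := fr) (a := k ^ 2)
    (isL2Field_of_memH10 hz)
  have h3 := h.energy_sub_cutProfile_le hDm hf hk hμ hμ' hD A
  have h4 := h.energy_sub_freeProfile_le hf hk hfD hA hM hDM
  have h5 : 0 ≤ ∫ p in D, energyDensity fl fr (k ^ 2)
      (fun i p => s i p - verticalField (freeProfile fl fr k A) i p)
      (fun i j p => Ds i j p - verticalJacobian (freeProfileDeriv fl fr k A) i j p)
      (fun i p => s i p - verticalField (freeProfile fl fr k A) i p)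
      (fun i j p => Ds i j p - verticalJacobian (freeProfileDeriv fl fr k A) i j p) p :=
    integral_nonneg fun p => energyDensity_self_nonneg (sq_nonneg k) p
  have h6 : ∫ p in film N fl fr, ((∑ i, Ds i i p) - A) ^ 2
      = ∫ p in film N fl fr, (∑ i, (Ds i i p
        - verticalJacobian (cutProfileDeriv fl fr k μ A) i i p)) ^ 2 := by
    refine setIntegral_congr_fun measurableSet_film fun p hp => ?_
    simp only [Finset.sum_sub_distrib, sum_verticalJacobian_diag]
    rw [cutProfileDeriv_of_mem hk hμ hp]
  have hs := sinh_pos hk hμ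
  have h7 : 1 ≤ Real.cosh (μ / k) / Real.sinh (μ / k) := by
    rw [le_div_iff₀ hs, one_mul]; exact (Real.sinh_lt_cosh _).le
  have hT : 0 < fr - fl := by linarith
  have hA0 : 0 < A := by
    by_contra hneg
    have : A * (k ^ 2 + k * (fr - fl) / 2) ≤ 0 :=
      mul_nonpos_of_nonpos_of_nonneg (not_lt.1 hneg) (by positivity)
    linarith
  have h8 : A * (fr - fl) ≤ 2 / k := by
    rw [le_div_iff₀ hk]
    have : 0 ≤ A * k ^ 2 := by positivity
    nlinarith
  set c := Real.cosh (μ / k) / Real.sinh (μ / k)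
  have h9 : k ^ 2 * ∫ p in film N fl fr, ((∑ i, Ds i i p) - A) ^ 2
      ≤ (A * (fr - fl)) ^ 2 * (k / 2) * (c - 1) := by
    rw [h6]
    have h10 := mul_le_mul_of_nonneg_left h1 (sq_nonneg k)
    have h11 : A * (fr - fl) = (A * (fr - fl)) * (A * (k ^ 2 + k * (fr - fl) / 2)) := by
      rw [hA, mul_one]
    have h12 : (A * (fr - fl)) ^ 2 * (k / 2) * (c - 1) = -(A * (fr - fl))
        + (k ^ 2 * A ^ 2 * (fr - fl) + (A * (fr - fl)) ^ 2 / 2 * k * c) := by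
      linear_combination h11
    rw [h12]
    linarith
  refine h9.trans ?_
  have h10 : (A * (fr - fl)) ^ 2 ≤ (2 / k) ^ 2 := pow_le_pow_left₀ (by positivity) h8 2
  calc (A * (fr - fl)) ^ 2 * (k / 2) * (c - 1) ≤ (2 / k) ^ 2 * (k / 2) * (c - 1) := by
        gcongr
    _ = 2 / k * (c - 1) := by field_simp

/-- Now the energy of s - C is discarded. The slope B is the one that maximises the lower bound 2BT
- k²B²T - (BT)²(k/2)coth(μ/k) for L(s); its maximum is BT, which leaves (A - B)T. -/
theorem IsWeakSolution.energy_sub_freeProfile_le_coth [IsFiniteMeasure (volume.restrict D)]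
    (h : IsWeakSolution D (film N fl fr) (k ^ 2) s Ds)
    (hDm : MeasurableSet D) (hf : fl < fr) (hk : 0 < k) (hμ : 0 < μ) (hμ' : μ < μ')
    (hD : ∀ p : Space N, fl - μ' ≤ p.2 → p.2 ≤ fr + μ' → p ∈ D)
    (hA : A * (k ^ 2 + k * (fr - fl) / 2) = 1) (hM : 0 ≤ M)
    (hDM : ∀ p ∈ D, fl - M < p.2 ∧ p.2 ≤ fr + M) :
    ∫ p in D, energyDensity fl fr (k ^ 2)
      (fun i p => s i p - verticalField (freeProfile fl fr k A) i p)
      (fun i j p => Ds i j p - verticalJacobian (freeProfileDeriv fl fr k A) i j p)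
      (fun i p => s i p - verticalField (freeProfile fl fr k A) i p)
      (fun i j p => Ds i j p - verticalJacobian (freeProfileDeriv fl fr k A) i j p) p
      ≤ 2 / k * (1 - Real.sinh (μ / k) / Real.cosh (μ / k)) := by
  have hfD := film_subset (hμ.trans hμ') hD
  have hs := sinh_pos hk hμ
  have hch := Real.cosh_pos (μ / k)
  have hT : 0 < fr - fl := by linarith
  set c := Real.cosh (μ / k) / Real.sinh (μ / k) with hc
  have hcpos : 0 < c := div_pos hch hs
  have h7 : 1 ≤ c := by
    rw [hc, le_div_iff₀ hs, one_mul]; exact (Real.sinh_lt_cosh _).le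
  have hden : 0 < k ^ 2 + k * (fr - fl) / 2 * c := by positivity
  set B := (k ^ 2 + k * (fr - fl) / 2 * c)⁻¹ with hB
  have hB1 : B * (k ^ 2 + k * (fr - fl) / 2 * c) = 1 := inv_mul_cancel₀ hden.ne'
  have hB0 : 0 < B := inv_pos.2 hden
  have hA0 : 0 < A := by
    by_contra hneg
    have : A * (k ^ 2 + k * (fr - fl) / 2) ≤ 0 :=
      mul_nonpos_of_nonpos_of_nonneg (not_lt.1 hneg) (by positivity)
    linarith
  have h3 := h.energy_sub_cutProfile_le hDm hf hk hμ hμ' hD B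
  have h4 := h.energy_sub_freeProfile_le hf hk hfD hA hM hDM
  have h5 : 0 ≤ ∫ p in D, energyDensity fl fr (k ^ 2)
      (fun i p => s i p - verticalField (cutProfile fl fr k μ B) i p)
      (fun i j p => Ds i j p - verticalJacobian (cutProfileDeriv fl fr k μ B) i j p)
      (fun i p => s i p - verticalField (cutProfile fl fr k μ B) i p)
      (fun i j p => Ds i j p - verticalJacobian (cutProfileDeriv fl fr k μ B) i j p) p :=
    integral_nonneg fun p => energyDensity_self_nonneg (sq_nonneg k) p
  have hinv : Real.sinh (μ / k) / Real.cosh (μ / k) = 1 / c := by rw [hc, one_div_div]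
  rw [hinv]
  have h8 : A * (k * (fr - fl) / 2) ≤ 1 := by
    have : 0 ≤ A * k ^ 2 := by positivity
    linarith
  have h9 : B * (fr - fl) ≤ 2 / (k * c) := by
    rw [le_div_iff₀ (by positivity)]
    have : 0 ≤ B * k ^ 2 := by positivity
    nlinarith
  have h10 : k ^ 2 * B ^ 2 * (fr - fl) + (B * (fr - fl)) ^ 2 / 2 * k * c = B * (fr - fl) := by
    linear_combination (B * (fr - fl)) * hB1
  have h11 : A - B = A * (k * (fr - fl) / 2) * B * (c - 1) := by
    linear_combination B * hA - A * hB1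
  have h12 : (A - B) * (fr - fl) ≤ 2 / k * (1 - 1 / c) := by
    calc (A - B) * (fr - fl) = A * (k * (fr - fl) / 2) * (B * (fr - fl)) * (c - 1) := by
          rw [h11]; ring
      _ ≤ 1 * (2 / (k * c)) * (c - 1) := by
          gcongr
      _ = 2 / k * (1 - 1 / c) := by field_simp
  rw [h10] at h3
  linarith

end WeakSolution

end StraightFilm

namespace StraightFilm

/-! ### Localised decay estimate, the two regimes of μ/k, and the L² bound on the thickness. -/

variable {N : ℕ} {D : Set (Space N)} {fl fr k μ μ' a A B M : ℝ}
  {s : Coord N → Space N → ℝ} {Ds : Coord N → Coord N → Space N → ℝ}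

/-- A Caccioppoli argument: w = s - V solves the homogeneous equation in D, and testing with η²w
bounds D(ηw) by the localisation error k²η'² - (1 - χ_Ω)η² ≤ (1 - χ_Ω)/sinh²(μ/k). So the energy of
w is improved by the factor 1/sinh²(μ/k), while η = 1 on the film. -/
theorem IsWeakSolution.integral_film_div_sub_sq_le_of_freeProfile
    [IsFiniteMeasure (volume.restrict D)] (h : IsWeakSolution D (film N fl fr) (k ^ 2) s Ds)
    (hDm : MeasurableSet D) (hf : fl < fr) (hk : 0 < k) (hμ : 0 < μ) (hμ' : μ < μ')
    (hD : ∀ p : Space N, fl - μ' ≤ p.2 → p.2 ≤ fr + μ' → p ∈ D)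
    (hA : A * (k ^ 2 + k * (fr - fl) / 2) = 1) (hM : 0 ≤ M)
    (hDM : ∀ p ∈ D, fl - M < p.2 ∧ p.2 ≤ fr + M) :
    k ^ 2 * ∫ p in film N fl fr, ((∑ i, Ds i i p) - A) ^ 2
      ≤ 2 / k * (1 - Real.sinh (μ / k) / Real.cosh (μ / k)) / Real.sinh (μ / k) ^ 2 := by
  have hfD := film_subset (hμ.trans hμ') hD
  have hs := sinh_pos hk hμ
  set w : Coord N → Space N → ℝ := fun i p => s i p - verticalField (freeProfile fl fr k A) i p
    with hw
  set Dw : Coord N → Coord N → Space N → ℝ := fun i j p =>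
    Ds i j p - verticalJacobian (freeProfileDeriv fl fr k A) i j p with hDw
  have hwL : IsL2Field D w Dw :=
    (isL2Field_of_memH10 h.memH10).sub (isL2Field_freeProfile hf hk A)
  set η := cutoff fl fr k μ with hη
  set η' := cutoffDeriv fl fr k μ with hη'
  set z : Coord N → Space N → ℝ := fun i p => η p.2 * w i p with hzdef
  set Dz : Coord N → Coord N → Space N → ℝ := fun i j p =>
    η p.2 * Dw i j p + if j = Sum.inr () then η' p.2 * w i p else 0 with hDz
  -- w need not vanish on ∂D; ηw is handled as the difference of ηs and ηV.
  have hz : ∀ i, MemH10 D (z i) (Dz i) := by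
    intro i
    have h1 := ((h.memH10 i).mul_snd (lipschitzWith_cutoff (fl := fl) (fr := fr) hk hμ)
      (fun _ => abs_cutoff_le hk hμ) (hasDerivAt_cutoff hf) fun _ => abs_cutoffDeriv_le hk hμ).sub
      (isVerticalH10_expProfile_mul_cutProfile hf hk hμ hμ' hD A i)
    convert h1 using 1
    · ext p
      simp only [hzdef, hw, verticalField, freeProfile, cutProfile]
      split_ifs <;> ring
    · ext j p
      simp only [hDz, hDw, hw, verticalField, verticalJacobian, freeProfile, cutProfile,
        freeProfileDeriv, cutProfileDeriv]
      split_ifs <;> ring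
  set u : Coord N → Space N → ℝ := fun i p => η p.2 * z i p with hudef
  set Du : Coord N → Coord N → Space N → ℝ := fun i j p =>
    η p.2 * Dz i j p + if j = Sum.inr () then η' p.2 * z i p else 0 with hDu
  have hu : ∀ i, MemH10 D (u i) (Du i) := fun i =>
    (hz i).mul_snd (lipschitzWith_cutoff (fl := fl) (fr := fr) hk hμ)
      (fun _ => abs_cutoff_le hk hμ) (hasDerivAt_cutoff hf) fun _ => abs_cutoffDeriv_le hk hμ
  have huL := isL2Field_of_memH10 hu
  have hzL := isL2Field_of_memH10 hz
  have horth : ∫ p in D, energyDensity fl fr (k ^ 2) w Dw u Du p = 0 := by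
    have h1 : ∀ p, energyDensity fl fr (k ^ 2) w Dw u Du p
        = energyDensity fl fr (k ^ 2) s Ds u Du p
          - energyDensity fl fr (k ^ 2) (verticalField (freeProfile fl fr k A))
            (verticalJacobian (freeProfileDeriv fl fr k A)) u Du p := by
      intro p
      simp only [energyDensity, hw, hDw, sub_mul, Finset.sum_sub_distrib]
      ring
    simp only [h1]
    rw [integral_sub ((isL2Field_of_memH10 h.memH10).integrable_energyDensity huL)
      ((isL2Field_freeProfile hf hk A).integrable_energyDensity huL),
      h.integral_energyDensity hf hfD hu, integral_energyDensity_freeProfile hf hk hA hu, sub_self]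
  -- The pointwise identity |D(ηw)|² = Dw : D(η²w) + η'²|w|², with the zero-order term of the energy
  -- added and subtracted.
  have hpt : ∀ p, k ^ 2 * (∑ i, ∑ j, Dz i j p * Dz i j p)
      = energyDensity fl fr (k ^ 2) w Dw u Du p
        + (k ^ 2 * η' p.2 ^ 2 - filmSide fl fr p.2 ^ 2 * η p.2 ^ 2) * ∑ i, w i p * w i p := by
    intro p
    have h1 : ∑ i, ∑ j, Dz i j p * Dz i j p
        = (∑ i, ∑ j, Dw i j p * Du i j p) + η' p.2 ^ 2 * ∑ i, w i p * w i p := by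
      rw [Finset.mul_sum, ← Finset.sum_add_distrib]
      refine Finset.sum_congr rfl fun i _ => ?_
      have h2 : η' p.2 ^ 2 * (w i p * w i p)
          = ∑ j : Coord N, if j = Sum.inr () then η' p.2 ^ 2 * (w i p * w i p) else 0 := by simp
      rw [h2, ← Finset.sum_add_distrib]
      refine Finset.sum_congr rfl fun j _ => ?_
      simp only [hDz, hDu, hzdef]
      split_ifs <;> ring
    have h2 : ∑ i, w i p * u i p = η p.2 ^ 2 * ∑ i, w i p * w i p := by
      rw [Finset.mul_sum]
      exact Finset.sum_congr rfl fun i _ => by simp only [hudef, hzdef]; ring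
    rw [energyDensity, h1, h2]
    ring
  have hle : k ^ 2 * ∫ p in D, ∑ i, ∑ j, Dz i j p * Dz i j p
      ≤ 1 / Real.sinh (μ / k) ^ 2 * ∫ p in D, energyDensity fl fr (k ^ 2) w Dw w Dw p := by
    have h1 : ∫ p in D, energyDensity fl fr (k ^ 2) w Dw u Du p
        + 1 / Real.sinh (μ / k) ^ 2 * energyDensity fl fr (k ^ 2) w Dw w Dw p
        = 1 / Real.sinh (μ / k) ^ 2 * ∫ p in D, energyDensity fl fr (k ^ 2) w Dw w Dw p := by
      rw [integral_add (hwL.integrable_energyDensity huL)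
        ((hwL.integrable_energyDensity hwL).const_mul _), horth, zero_add, integral_const_mul]
    rw [← h1, ← integral_const_mul]
    refine integral_mono ((hzL.integrable_grad_mul hzL).const_mul _)
      ((hwL.integrable_energyDensity huL).add
        ((hwL.integrable_energyDensity hwL).const_mul _)) fun p => ?_
    simp only
    rw [hpt]
    refine add_le_add le_rfl ?_
    have h2 : 0 ≤ ∑ i, w i p * w i p := Finset.sum_nonneg fun _ _ => mul_self_nonneg _
    have h3 : 0 ≤ k ^ 2 * ∑ i, ∑ j, Dw i j p * Dw i j p := mul_nonneg (sq_nonneg k)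
      (Finset.sum_nonneg fun _ _ => Finset.sum_nonneg fun _ _ => mul_self_nonneg _)
    calc (k ^ 2 * η' p.2 ^ 2 - filmSide fl fr p.2 ^ 2 * η p.2 ^ 2) * ∑ i, w i p * w i p
        ≤ filmSide fl fr p.2 ^ 2 / Real.sinh (μ / k) ^ 2 * ∑ i, w i p * w i p :=
          mul_le_mul_of_nonneg_right (sq_mul_cutoffDeriv_sq_sub hk hμ) h2
      _ = 1 / Real.sinh (μ / k) ^ 2 * (filmSide fl fr p.2 ^ 2 * ∑ i, w i p * w i p) := by ring
      _ ≤ 1 / Real.sinh (μ / k) ^ 2 * energyDensity fl fr (k ^ 2) w Dw w Dw p := by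
          refine mul_le_mul_of_nonneg_left ?_ (by positivity)
          rw [energyDensity]
          linarith
  have hdiv := integral_film_div_sq_le (fl := fl) (fr := fr) hz hfD
  have hcongr : ∫ p in film N fl fr, ((∑ i, Ds i i p) - A) ^ 2
      = ∫ p in film N fl fr, (∑ i, Dz i i p) ^ 2 := by
    refine setIntegral_congr_fun measurableSet_film fun p hp => ?_
    have hp' : p.2 ∈ Set.Ioo fl fr := hp
    simp only [hDz, hDw, hη, hη', cutoff_of_mem hk hμ ⟨hp'.1.le, hp'.2.le⟩,
      cutoffDeriv_of_mem hp', one_mul, zero_mul, ite_self, add_zero, Finset.sum_sub_distrib,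
      sum_verticalJacobian_diag]
    rw [freeProfileDeriv, filmSide_of_mem hp', expProfile_of_mem ⟨hp'.1.le, hp'.2.le⟩]
    ring
  have hen := h.energy_sub_freeProfile_le_coth hDm hf hk hμ hμ' hD hA hM hDM
  rw [hcongr]
  calc k ^ 2 * ∫ p in film N fl fr, (∑ i, Dz i i p) ^ 2
      ≤ k ^ 2 * ∫ p in D, ∑ i, ∑ j, Dz i j p * Dz i j p :=
        mul_le_mul_of_nonneg_left hdiv (sq_nonneg k)
    _ ≤ _ := hle
    _ ≤ 1 / Real.sinh (μ / k) ^ 2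
        * (2 / k * (1 - Real.sinh (μ / k) / Real.cosh (μ / k))) :=
        mul_le_mul_of_nonneg_left hen (by positivity)
    _ = _ := by ring

/-- Since coth x - 1 = e^{-x}/sinh x, the claim is equivalent to x ≤ 1 - e^{-2x}, which fails from
slightly below x = 0.8 on. -/
theorem coth_sub_one_le {x : ℝ} (hx : 0 < x) (hx' : x ≤ 7 / 10) :
    x * (Real.cosh x / Real.sinh x - 1) ≤ 2 * Real.exp (-x) ^ 2 := by
  have hs : 0 < Real.sinh x := Real.sinh_pos_iff.2 hx
  have hE : 0 < Real.exp (-x) := Real.exp_pos _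
  have h1 : Real.exp x * Real.exp (-x) = 1 := by rw [← Real.exp_add]; simp
  have h2 : Real.cosh x / Real.sinh x - 1 = Real.exp (-x) / Real.sinh x := by
    rw [← Real.cosh_sub_sinh]; field_simp
  have h3 : Real.sinh x * Real.exp (-x) * 2 = 1 - Real.exp (-x) ^ 2 := by
    rw [Real.sinh_eq]; linear_combination h1
  have h4 : x ≤ 1 - Real.exp (-x) ^ 2 := by
    have h5 := Real.quadratic_le_exp_of_nonneg (x := 2 * x) (by linarith)
    have h6 : Real.exp (-x) ^ 2 * Real.exp (2 * x) = 1 := by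
      rw [← Real.exp_nat_mul, ← Real.exp_add]; simp
    have h7 : 1 ≤ (1 - x) * Real.exp (2 * x) := by
      nlinarith [mul_le_mul_of_nonneg_left h5 (show 0 ≤ 1 - x by linarith), sq_nonneg x,
        mul_pos hx hx]
    have h8 : 0 < Real.exp (2 * x) := Real.exp_pos _
    by_contra hneg
    nlinarith
  rw [h2, mul_div_assoc', div_le_iff₀ hs]
  nlinarith

/-- The claim is equivalent to 4x ≤ e^{2x} - 1 - e^{-2x} + e^{-4x}. This is already close to
equality at 7/10, the point at which `coth_sub_one_le` takes over. -/
theorem one_sub_tanh_le {x : ℝ} (hx : 7 / 10 ≤ x) :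
    x * (1 - Real.sinh x / Real.cosh x) / Real.sinh x ^ 2 ≤ 2 * Real.exp (-x) ^ 2 := by
  have hx0 : 0 < x := by linarith
  have hs : 0 < Real.sinh x := Real.sinh_pos_iff.2 hx0
  have hc : 0 < Real.cosh x := Real.cosh_pos x
  have hE : 0 < Real.exp (-x) := Real.exp_pos _
  have h1 : Real.exp x * Real.exp (-x) = 1 := by rw [← Real.exp_add]; simp
  have h2 : 1 - Real.sinh x / Real.cosh x = Real.exp (-x) / Real.cosh x := by
    rw [← Real.cosh_sub_sinh]; field_simp
  rw [h2, div_le_iff₀ (by positivity), mul_div_assoc', div_le_iff₀ hc]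
  have h3 : x ≤ 2 * Real.exp (-x) * Real.cosh x * Real.sinh x ^ 2 := by
    have h4 : 2 * Real.exp (-x) * Real.cosh x * Real.sinh x ^ 2
        = (Real.exp x ^ 2 - 1 - Real.exp (-x) ^ 2 + Real.exp (-x) ^ 4) / 4 := by
      rw [Real.cosh_eq, Real.sinh_eq]
      linear_combination (Real.exp x ^ 2 / 4 - Real.exp x * Real.exp (-x) / 4
        - 1 / 4 - Real.exp (-x) ^ 2 / 4) * h1
    -- The slack at x = 7/10 is small, so e^{7/5} is needed to two decimals; it is obtained from e⁷
    -- by comparing fifth powers. The tangent line at 7/10 then extends the bound to larger x.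
    have h5 : (405 : ℝ) / 100 ≤ Real.exp (7 / 5) := by
      by_contra hneg
      have h6 : Real.exp (7 / 5) ^ 5 < (405 / 100) ^ 5 :=
        pow_lt_pow_left₀ (not_le.1 hneg) (Real.exp_pos _).le (by norm_num)
      have h7 : Real.exp (7 / 5) ^ 5 = Real.exp 1 ^ 7 := by
        rw [← Real.exp_nat_mul, ← Real.exp_nat_mul]; norm_num
      have h8 : (2.718 : ℝ) ^ 7 ≤ Real.exp 1 ^ 7 :=
        pow_le_pow_left₀ (by norm_num) (by linarith [Real.exp_one_gt_d9]) 7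
      rw [h7] at h6
      norm_num at h8 h6
      linarith
    have h6 : 405 / 100 * (2 * x - 2 / 5) ≤ Real.exp x ^ 2 := by
      have h7 : Real.exp x ^ 2 = Real.exp (7 / 5) * Real.exp (2 * x - 7 / 5) := by
        rw [← Real.exp_nat_mul, ← Real.exp_add]; congr 1; push_cast; ring
      rw [h7]
      have h8 := Real.add_one_le_exp (2 * x - 7 / 5)
      exact mul_le_mul h5 (by linarith) (by linarith) (Real.exp_pos _).le
    have h7 : Real.exp (-x) ^ 2 * Real.exp x ^ 2 = 1 := by
      rw [← mul_pow, mul_comm, h1, one_pow]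
    have h8 : Real.exp (-x) ^ 2 ≤ 100 / 405 := by
      have : (405 : ℝ) / 100 ≤ Real.exp x ^ 2 := by linarith
      nlinarith [sq_nonneg (Real.exp (-x))]
    rw [h4]
    have : 0 ≤ Real.exp (-x) ^ 4 := by positivity
    linarith
  calc x * Real.exp (-x) ≤ 2 * Real.exp (-x) * Real.cosh x * Real.sinh x ^ 2 * Real.exp (-x) :=
        mul_le_mul_of_nonneg_right h3 hE.le
    _ = _ := by ring

theorem IsWeakSolution.integral_film_div_sub_sq_le
    [IsFiniteMeasure (volume.restrict D)] (h : IsWeakSolution D (film N fl fr) (k ^ 2) s Ds)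
    (hDm : MeasurableSet D) (hf : fl < fr) (hk : 0 < k) (hμ : 0 < μ) (hμ' : μ < μ')
    (hD : ∀ p : Space N, fl - μ' ≤ p.2 → p.2 ≤ fr + μ' → p ∈ D)
    (hA : A * (k ^ 2 + k * (fr - fl) / 2) = 1) (hM : 0 ≤ M)
    (hDM : ∀ p ∈ D, fl - M < p.2 ∧ p.2 ≤ fr + M) :
    (k / 2) ^ 2 * ∫ p in film N fl fr, ((∑ i, Ds i i p) - A) ^ 2
      ≤ Real.exp (-(μ / k)) ^ 2 / μ := by
  have hx : 0 < μ / k := div_pos hμ hk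
  have hkx : 1 / k = μ / k / μ := by field_simp
  have key : ∀ {r : ℝ}, k ^ 2 * ∫ p in film N fl fr, ((∑ i, Ds i i p) - A) ^ 2 ≤ 2 / k * r →
      μ / k * r ≤ 2 * Real.exp (-(μ / k)) ^ 2 →
      (k / 2) ^ 2 * ∫ p in film N fl fr, ((∑ i, Ds i i p) - A) ^ 2
        ≤ Real.exp (-(μ / k)) ^ 2 / μ := by
    intro r h1 h2
    rw [le_div_iff₀ hμ]
    have h3 : 2 / k * r * μ = 2 * (μ / k * r) := by ring
    nlinarith [mul_le_mul_of_nonneg_right h1 hμ.le]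
  rcases le_total (μ / k) (7 / 10) with hle | hle
  · exact key (h.integral_film_div_sub_sq_le_of_cutProfile hDm hf hk hμ hμ' hD hA hM hDM)
      (coth_sub_one_le hx hle)
  · refine key (r := (1 - Real.sinh (μ / k) / Real.cosh (μ / k)) / Real.sinh (μ / k) ^ 2) ?_ ?_
    · rw [mul_div_assoc']
      exact h.integral_film_div_sub_sq_le_of_freeProfile hDm hf hk hμ hμ' hD hA hM hDM
    · rw [mul_div_assoc']
      exact one_sub_tanh_le hle

theorem eLpNorm_two_le_of_integral_sq_le {α : Type*} [MeasurableSpace α] {m : Measure α}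
    {f : α → ℝ} (hf : MemLp f 2 m) {c : ℝ} (hc : 0 ≤ c) (h : ∫ x, f x ^ 2 ∂m ≤ c ^ 2) :
    eLpNorm f 2 m ≤ ENNReal.ofReal c := by
  rw [hf.eLpNorm_eq_integral_rpow_norm (by norm_num) (by norm_num)]
  refine ENNReal.ofReal_le_ofReal ?_
  simp only [ENNReal.toReal_ofNat, Real.rpow_two, Real.norm_eq_abs, sq_abs]
  rw [← one_div, ← Real.sqrt_eq_rpow]
  exact (Real.sqrt_le_sqrt h).trans (le_of_eq (Real.sqrt_sq hc))

/-- This also holds where div s = 0: division by zero gives thickness 0, and its reciprocal is again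
0. -/
theorem one_div_thickness (p : Space N) :
    1 / thickness a Ds p = √a / 2 * ∑ i, Ds i i p := by
  rw [thickness, one_div_div]; ring

theorem IsWeakSolution.eLpNorm_thickness_le_of_lt
    [IsFiniteMeasure (volume.restrict D)] (ha : 0 < a)
    (h : IsWeakSolution D (film N fl fr) a s Ds)
    (hDm : MeasurableSet D) (hf : fl < fr) (hμ : 0 < μ) (hμ' : μ < μ')
    (hD : ∀ p : Space N, fl - μ' ≤ p.2 → p.2 ≤ fr + μ' → p ∈ D) (hM : 0 ≤ M)
    (hDM : ∀ p ∈ D, fl - M < p.2 ∧ p.2 ≤ fr + M) :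
    eLpNorm (fun p => 1 / thickness a Ds p - 1 / (fr - fl)) 2 (volume.restrict (film N fl fr))
      ≤ ENNReal.ofReal (2 / √(fr - fl) ^ 3 * √a + 1 / √μ * Real.exp (-(μ / √a))) := by
  have hk : 0 < √a := Real.sqrt_pos.2 ha
  have hT : 0 < fr - fl := by linarith
  have hak : a = √a ^ 2 := (Real.sq_sqrt ha.le).symm
  rw [hak] at h
  simp only [one_div_thickness]
  set k := √a with hkdef
  have hden : 0 < k ^ 2 + k * (fr - fl) / 2 := by positivity
  set A := (k ^ 2 + k * (fr - fl) / 2)⁻¹ with hAdef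
  have hA : A * (k ^ 2 + k * (fr - fl) / 2) = 1 := inv_mul_cancel₀ hden.ne'
  have hmain := h.integral_film_div_sub_sq_le hDm hf hk hμ hμ' hD hA hM hDM
  have hfD := film_subset (hμ.trans hμ') hD
  have hfin : IsFiniteMeasure (volume.restrict (film N fl fr)) :=
    ⟨by rw [Measure.restrict_apply_univ, volume_film]; exact ENNReal.ofReal_lt_top⟩
  have hdivL : MemLp (fun p => ∑ i, Ds i i p) 2 (volume.restrict (film N fl fr)) :=
    (isL2Field_of_memH10 h.memH10).memLp_div.mono_measure (Measure.restrict_mono hfD le_rfl)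
  have hsplit : (fun p => k / 2 * ∑ i, Ds i i p - 1 / (fr - fl))
      = (fun p => k / 2 * (∑ i, Ds i i p - A)) + fun _ => k / 2 * A - 1 / (fr - fl) := by
    ext p; simp only [Pi.add_apply]; ring
  have hfL : MemLp (fun p => k / 2 * (∑ i, Ds i i p - A)) 2 (volume.restrict (film N fl fr)) :=
    (hdivL.sub (memLp_const A)).const_mul (k / 2)
  have h1 : eLpNorm (fun p => k / 2 * (∑ i, Ds i i p - A)) 2 (volume.restrict (film N fl fr))
      ≤ ENNReal.ofReal (1 / √μ * Real.exp (-(μ / k))) := by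
    refine eLpNorm_two_le_of_integral_sq_le hfL (by positivity) ?_
    simp only [mul_pow (k / 2)]
    rw [integral_const_mul]
    refine hmain.trans (le_of_eq ?_)
    rw [mul_pow, div_pow, Real.sq_sqrt hμ.le]
    ring
  -- Here kA/2 = 1/(T + 2k), so the difference is 2k/(T(T + 2k)). Multiplied by the square root of
  -- the film's volume T, the bound 2k/T² becomes 2k/T^{3/2}.
  have hconst : |k / 2 * A - 1 / (fr - fl)| ≤ 2 * k / (fr - fl) ^ 2 := by
    have h2 : k / 2 * A = 1 / (2 * k + (fr - fl)) := by
      rw [hAdef]; field_simp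
    rw [h2, abs_sub_comm, abs_of_nonneg (sub_nonneg.2 (one_div_le_one_div_of_le hT (by linarith)))]
    rw [div_sub_div _ _ hT.ne' (by positivity), div_le_div_iff₀ (by positivity) (by positivity)]
    nlinarith [mul_pos hk hT, mul_pos (mul_pos hk hT) hk, mul_pos (mul_pos hk hT) hT]
  have h2 : eLpNorm (fun _ : Space N => k / 2 * A - 1 / (fr - fl)) 2
      (volume.restrict (film N fl fr)) ≤ ENNReal.ofReal (2 / √(fr - fl) ^ 3 * k) := by
    refine eLpNorm_two_le_of_integral_sq_le (memLp_const _) (by positivity) ?_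
    rw [setIntegral_const, measureReal_def, volume_film, ENNReal.toReal_ofReal hT.le, smul_eq_mul,
      ← sq_abs]
    refine (mul_le_mul_of_nonneg_left (pow_le_pow_left₀ (abs_nonneg _) hconst 2) hT.le).trans
      (le_of_eq ?_)
    have h3 : (√(fr - fl) ^ 3) ^ 2 = (fr - fl) ^ 3 := by
      rw [← pow_mul, mul_comm, pow_mul, Real.sq_sqrt hT.le]
    rw [mul_pow (2 / √(fr - fl) ^ 3), div_pow 2 (√(fr - fl) ^ 3), h3]
    field_simp
  rw [hsplit]
  refine (eLpNorm_add_le hfL.aestronglyMeasurable aestronglyMeasurable_const (by norm_num)).trans ?_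
  rw [add_comm, ENNReal.ofReal_add (by positivity) (by positivity)]
  exact add_le_add h2 h1

end StraightFilm

namespace StraightFilm

/-! ### Margins of the domain and passage to the limit. -/

variable {N : ℕ} {bl br : UnitAddTorus (Fin N) → ℝ} {fl fr a : ℝ}

theorem isBounded_range {b : UnitAddTorus (Fin N) → ℝ} (hb : Continuous b) :
    BddAbove (Set.range b) ∧ BddBelow (Set.range b) :=
  ⟨(isCompact_range hb).bddAbove, (isCompact_range hb).bddBelow⟩

/-- Subtracting the oscillation of b_r from max b_r - f_r leaves min b_r - f_r, and likewise for
b_l; R subtracts the larger oscillation from the smaller distance. -/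
theorem marginR_le_innerMargin : marginR bl br fl fr ≤ innerMargin bl br fl fr := by
  rw [marginR, innerMargin, le_min_iff]
  have h1 := min_le_left ((⨆ x, br x) - fr) (fl - ⨅ x, bl x)
  have h2 := min_le_right ((⨆ x, br x) - fr) (fl - ⨅ x, bl x)
  have h3 := le_max_left ((⨆ x, br x) - ⨅ x, br x) ((⨆ x, bl x) - ⨅ x, bl x)
  have h4 := le_max_right ((⨆ x, br x) - ⨅ x, br x) ((⨆ x, bl x) - ⨅ x, bl x)
  constructor <;> linarith

theorem marginR_le_outerMargin (hbr : Continuous br) :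
    marginR bl br fl fr ≤ outerMargin bl br fl fr := by
  rw [marginR, outerMargin]
  have h1 := isBounded_range hbr
  have h2 : (⨅ x, br x) ≤ ⨆ x, br x := (ciInf_le h1.2 0).trans (le_ciSup h1.1 0)
  have h3 := le_max_left ((⨆ x, br x) - ⨅ x, br x) ((⨆ x, bl x) - ⨅ x, bl x)
  linarith

theorem measurableSet_globalDomain (hbl : Continuous bl) (hbr : Continuous br) :
    MeasurableSet (globalDomain bl br) :=
  (measurableSet_lt (hbl.measurable.comp measurable_fst) measurable_snd).inter
    (measurableSet_lt measurable_snd (hbr.measurable.comp measurable_fst))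

theorem mem_globalDomain (hbl : Continuous bl) (hbr : Continuous br) {μ : ℝ}
    (hμ : μ < innerMargin bl br fl fr) (p : Space N) (h1 : fl - μ ≤ p.2) (h2 : p.2 ≤ fr + μ) :
    p ∈ globalDomain bl br := by
  rw [innerMargin, lt_min_iff] at hμ
  have h3 := ciInf_le (isBounded_range hbr).2 p.1
  have h4 := le_ciSup (isBounded_range hbl).1 p.1
  constructor <;> linarith

theorem exists_slab_globalDomain (hbl : Continuous bl) (hbr : Continuous br) (fl fr : ℝ) :
    ∃ M, 0 ≤ M ∧ ∀ p ∈ globalDomain bl br, fl - M < p.2 ∧ p.2 ≤ fr + M := by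
  refine ⟨max 0 (max (fl - ⨅ x, bl x) ((⨆ x, br x) - fr)), le_max_left _ _, fun p hp => ?_⟩
  have h1 := ciInf_le (isBounded_range hbl).2 p.1
  have h2 := le_ciSup (isBounded_range hbr).1 p.1
  have h3 := (le_max_left (fl - ⨅ x, bl x) ((⨆ x, br x) - fr)).trans (le_max_right 0 _)
  have h4 := (le_max_right (fl - ⨅ x, bl x) ((⨆ x, br x) - fr)).trans (le_max_right 0 _)
  have h5 := hp.1
  have h6 := hp.2
  constructor <;> linarith

theorem isFiniteMeasure_restrict_globalDomain (hbl : Continuous bl) (hbr : Continuous br) :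
    IsFiniteMeasure (volume.restrict (globalDomain bl br)) := by
  obtain ⟨M, -, hM⟩ := exists_slab_globalDomain hbl hbr 0 0
  have hmp : MeasurePreserving (Prod.snd : Space N → ℝ) := measurePreserving_snd
  refine ⟨?_⟩
  rw [Measure.restrict_apply_univ]
  refine (measure_mono (show globalDomain bl br ⊆ Prod.snd ⁻¹' Set.Ioc (0 - M) (0 + M)
    from fun p hp => hM p hp)).trans_lt ?_
  rw [hmp.measure_preimage measurableSet_Ioc.nullMeasurableSet, Real.volume_Ioc]
  exact ENNReal.ofReal_lt_top

/-- The competitor needs μ < m strictly, to fit with room to spare inside D. The bound is continuous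
in μ, so it survives the limit μ → m. -/
theorem IsWeakSolution.eLpNorm_thickness_le (hbl : Continuous bl) (hbr : Continuous br)
    (hf : fl < fr) (hm : 0 < innerMargin bl br fl fr) (ha : 0 < a)
    {s : Coord N → Space N → ℝ} {Ds : Coord N → Coord N → Space N → ℝ}
    (h : IsWeakSolution (globalDomain bl br) (film N fl fr) a s Ds) :
    eLpNorm (fun p => 1 / thickness a Ds p - 1 / (fr - fl)) 2 (volume.restrict (film N fl fr))
      ≤ ENNReal.ofReal (2 / √(fr - fl) ^ 3 * √a + 1 / √(innerMargin bl br fl fr)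
          * Real.exp (-(innerMargin bl br fl fr / √a))) := by
  have := isFiniteMeasure_restrict_globalDomain hbl hbr
  obtain ⟨M, hM, hDM⟩ := exists_slab_globalDomain hbl hbr fl fr
  set m := innerMargin bl br fl fr with hmdef
  have hbound : ∀ μ ∈ Set.Ioo 0 m, eLpNorm (fun p => 1 / thickness a Ds p - 1 / (fr - fl)) 2
      (volume.restrict (film N fl fr))
      ≤ ENNReal.ofReal (2 / √(fr - fl) ^ 3 * √a + 1 / √μ * Real.exp (-(μ / √a))) := by
    intro μ hμ
    obtain ⟨μ', h1, h2⟩ := exists_between hμ.2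
    exact h.eLpNorm_thickness_le_of_lt ha (measurableSet_globalDomain hbl hbr) hf hμ.1 h1
      (fun p => mem_globalDomain hbl hbr h2 p) hM hDM
  have hcont : ContinuousAt (fun μ : ℝ => 2 / √(fr - fl) ^ 3 * √a
      + 1 / √μ * Real.exp (-(μ / √a))) m := by
    refine continuousAt_const.add (ContinuousAt.mul ?_ ?_)
    · exact continuousAt_const.div Real.continuous_sqrt.continuousAt (Real.sqrt_pos.2 hm).ne'
    · exact (Real.continuous_exp.comp (continuous_id.div_const _).neg).continuousAt
  refine ge_of_tendsto (ENNReal.tendsto_ofReal (hcont.tendsto.mono_left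
    (nhdsWithin_le_nhds (s := Set.Iio m)))) ?_
  filter_upwards [Ioo_mem_nhdsLT hm] with μ hμ using hbound μ hμ

theorem tendsto_bound_zero {T R m : ℝ} (r : ℝ) (hR : 0 < R) (hr : 0 < r) :
    Tendsto (fun a : ℝ => 2 / √T ^ 3 * √a + 4 / √T * Real.exp (-2 * (r / √a))
      + 1 / √m * Real.exp (-(R / √a))) (𝓝[>] 0) (𝓝 0) := by
  have hs : Tendsto (fun a : ℝ => √a) (𝓝[>] 0) (𝓝[>] 0) := by
    refine tendsto_nhdsWithin_iff.2 ⟨?_, ?_⟩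
    · simpa using (Real.continuous_sqrt.tendsto 0).mono_left nhdsWithin_le_nhds
    · filter_upwards [self_mem_nhdsWithin] with a ha using Real.sqrt_pos.2 ha
  have hinv : Tendsto (fun a : ℝ => (√a)⁻¹) (𝓝[>] 0) atTop := tendsto_inv_nhdsGT_zero.comp hs
  have hexp : ∀ c : ℝ, 0 < c → Tendsto (fun a : ℝ => Real.exp (-(c * (√a)⁻¹))) (𝓝[>] 0) (𝓝 0) :=
    fun c hc => Real.tendsto_exp_neg_atTop_nhds_zero.comp (hinv.const_mul_atTop hc)
  have h1 := (((hs.mono_right nhdsWithin_le_nhds).const_mul (2 / √T ^ 3)).add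
    ((hexp (2 * r) (by positivity)).const_mul (4 / √T))).add ((hexp R hR).const_mul (1 / √m))
  simp only [mul_zero, add_zero] at h1
  refine h1.congr fun a => ?_
  have e1 : -2 * (r / √a) = -(2 * r * (√a)⁻¹) := by rw [div_eq_mul_inv]; ring
  have e2 : -(R / √a) = -(R * (√a)⁻¹) := by rw [div_eq_mul_inv]
  rw [e1, e2]

end StraightFilm

theorem mainTheorem1 (N : ℕ) (bl br : UnitAddTorus (Fin N) → ℝ)
    (hbl : Continuous bl) (hbr : Continuous br) (fl fr : ℝ) (hf : fl < fr)
    (hR : 0 < StraightFilm.marginR bl br fl fr) :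
    (0 < StraightFilm.outerMargin bl br fl fr ∧ 0 < StraightFilm.innerMargin bl br fl fr) ∧
    (∀ a : ℝ, 0 < a →
      ∀ (s : StraightFilm.Coord N → StraightFilm.Space N → ℝ)
        (Ds : StraightFilm.Coord N → StraightFilm.Coord N → StraightFilm.Space N → ℝ),
      StraightFilm.IsWeakSolution (StraightFilm.globalDomain bl br) (StraightFilm.film N fl fr)
        a s Ds →
      eLpNorm (fun p => 1 / StraightFilm.thickness a Ds p - 1 / (fr - fl)) 2
          (volume.restrict (StraightFilm.film N fl fr))
        ≤ ENNReal.ofReal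
          (2 / √(fr - fl) ^ 3 * √a
            + 4 / √(fr - fl) * Real.exp (-2 * (StraightFilm.outerMargin bl br fl fr / √a))
            + 1 / √(StraightFilm.innerMargin bl br fl fr)
                * Real.exp (-(StraightFilm.marginR bl br fl fr / √a)))) ∧
    (∀ (s : ℝ → StraightFilm.Coord N → StraightFilm.Space N → ℝ)
        (Ds : ℝ → StraightFilm.Coord N → StraightFilm.Coord N → StraightFilm.Space N → ℝ),
      (∀ a : ℝ, 0 < a → StraightFilm.IsWeakSolution (StraightFilm.globalDomain bl br)
        (StraightFilm.film N fl fr) a (s a) (Ds a)) →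
      Tendsto (fun a : ℝ => ∫⁻ p in StraightFilm.film N fl fr,
          ‖1 / StraightFilm.thickness a (Ds a) p - 1 / (fr - fl)‖ₑ ^ 2)
        (𝓝[>] 0) (𝓝 0)) := by
  have hRm := StraightFilm.marginR_le_innerMargin (bl := bl) (br := br) (fl := fl) (fr := fr)
  have hRo := StraightFilm.marginR_le_outerMargin (bl := bl) (fl := fl) (fr := fr) hbr
  have hm := hR.trans_le hRm
  have ho := hR.trans_le hRo
  have hest : ∀ a : ℝ, 0 < a →
      ∀ (s : StraightFilm.Coord N → StraightFilm.Space N → ℝ)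
        (Ds : StraightFilm.Coord N → StraightFilm.Coord N → StraightFilm.Space N → ℝ),
      StraightFilm.IsWeakSolution (StraightFilm.globalDomain bl br) (StraightFilm.film N fl fr)
        a s Ds →
      eLpNorm (fun p => 1 / StraightFilm.thickness a Ds p - 1 / (fr - fl)) 2
          (volume.restrict (StraightFilm.film N fl fr))
        ≤ ENNReal.ofReal
          (2 / √(fr - fl) ^ 3 * √a
            + 4 / √(fr - fl) * Real.exp (-2 * (StraightFilm.outerMargin bl br fl fr / √a))
            + 1 / √(StraightFilm.innerMargin bl br fl fr)
                * Real.exp (-(StraightFilm.marginR bl br fl fr / √a))) := by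
    intro a ha s Ds h
    refine (h.eLpNorm_thickness_le hbl hbr hf hm ha).trans (ENNReal.ofReal_le_ofReal ?_)
    -- The middle term of the stated bound is merely added, being nonnegative; the last one is
    -- weakened from e^{-m/√a} to e^{-R/√a}.
    refine add_le_add (le_add_of_nonneg_right (by positivity)) ?_
    gcongr
  refine ⟨⟨ho, hm⟩, hest, fun s Ds h => ?_⟩
  have h1 := ENNReal.tendsto_ofReal (StraightFilm.tendsto_bound_zero (T := fr - fl)
    (m := StraightFilm.innerMargin bl br fl fr) (StraightFilm.outerMargin bl br fl fr) hR ho)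
  rw [ENNReal.ofReal_zero] at h1
  have h2 : Tendsto (fun a : ℝ => eLpNorm (fun p => 1 / StraightFilm.thickness a (Ds a) p
      - 1 / (fr - fl)) 2 (volume.restrict (StraightFilm.film N fl fr))) (𝓝[>] 0) (𝓝 0) := by
    refine tendsto_of_tendsto_of_tendsto_of_le_of_le' tendsto_const_nhds h1
      (Eventually.of_forall fun _ => zero_le) ?_
    filter_upwards [self_mem_nhdsWithin] with a ha using hest a ha _ _ (h a ha)
  have h3 := h2.ennrpow_const 2
  rw [ENNReal.zero_rpow_of_pos (by norm_num)] at h3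
  refine h3.congr fun a => ?_
  rw [eLpNorm_eq_lintegral_rpow_enorm_toReal (by simp) (by simp), ← ENNReal.rpow_mul]
  simp
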